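/- **Setting.** Let $n\ge 2$, $p\in[1,2]$, $\frac1p+\frac1q=1$, $\|x\|_p=(\sum_i|x_i|^p)^{1/p}$ on $\mathbb R^n$, and $$\rho_n=\min\{q-1,\;16\ln n-8\}\,n^{\frac2q-1}$$ (for $p=1$, i.e. $q=\infty$: $\rho_n=(16\ln n-8)/n$). Consider $$\min_{x\in\mathbb R^n} f(x),\qquad f(x)=\mathbb E_\xi F(x,\xi),$$ where $\xi$ has distribution $P$ and, for $P$-almost every $\xi$, $F(\cdot,\xi)$ is convex with gradient $g(\cdot,\xi)$ which is $L(\xi)$-Lipschitz continuous in the Euclidean norm; $\sqrt{\mathbb E_\xi L(\xi)^2}\le L_2$ with $0<L_2<\infty$; and $\mathbb E_\xi\|g(x,\xi)-\nabla f(x)\|_2^2\le\sigma^2$ for all $x$. Let $x^*$ be a minimizer of $f$. For a point $x$, a sample $\xi$ and a direction $e$ in the Euclidean unit sphere $S_2(1)$, one observes $$\widetilde f'(x,\xi,e)=\langle g(x,\xi),e\rangle+\zeta(x,\xi,e)+\eta(x,\xi,e),$$ where for all $x\in\mathbb R^n$ and $e\in S_2(1)$: $\mathbb E_\xi\,\zeta(x,\xi,e)^2\le\Delta_\zeta$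 and $|\eta(x,\xi,e)|\le\Delta_\eta$ for almost every $\xi$. ($g$, $\zeta$, $\eta$ are jointly measurable.) Let $d$ be a prox-function, i.e. a differentiable convex function on $\mathbb R^n$ with $d(y)-d(x)-\langle\nabla d(x),y-x\rangle\ge\frac12\|y-x\|_p^2$ for all $x,y$, and let $V[z](x)=d(x)-d(z)-\langle\nabla d(z),x-z\rangle$. **Method (ARDD)** with starting point $x_0$, $N\ge1$ iterations and batch size $m\ge1$. Put $y_0=z_0=x_0$. For $k=0,\dots,N-1$, with $\alpha_{k+1}=\frac{k+2}{96n^2\rho_nL_2}$ and $\tau_k=\frac{2}{k+2}$: $$x_{k+1}=\tau_kz_k+(1-\tau_k)y_k,\qquad \widetilde\nabla^m f(x_{k+1})=\frac1m\sum_{i=1}^m\widetilde f'(x_{k+1},\xi_{k+1,i},e_{k+1})\,e_{k+1},$$ $$y_{k+1}=x_{k+1}-\frac1{2L_2}\widetilde\nabla^mf(x_{k+1}),\qquad z_{k+1}=\mathop{\arg\min}_{z\in\mathbb R^n}\Big\{\alpha_{k+1}n\big\langle\widetilde\nabla^mf(x_{k+1}),z-z_k\big\rangle+V[z_k](z)\Big\},$$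 where $e_1,\dots,e_N$ are uniformly distributed on $S_2(1)$, all $\xi_{k,i}$ ($1\le k\le N$, $1\le i\le m$) have distribution $P$, and all these random variables are independent. **Theorem.** With $\Theta_p=V[x_0](x^*)$, the random variable $f(y_N)$ is integrable and $$\begin{aligned}\mathbb E[f(y_N)]-f(x^*)\le{}&\frac{384\,\Theta_p\,n^2\rho_nL_2}{N^2}+\frac{4N}{nL_2}\cdot\frac{\sigma^2}{m}+\frac{61N}{24L_2}\Delta_\zeta+\frac{122N}{3L_2}\Delta_\eta^2\\&+\frac{12\sqrt{2n\Theta_p}}{N^2}\Big(\frac{\sqrt{\Delta_\zeta}}2+2\Delta_\eta\Big)+\frac{N^2}{12n\rho_nL_2}\Big(\frac{\sqrt{\Delta_\zeta}}2+2\Delta_\eta\Big)^2,\end{aligned}$$ where $\mathbb E$ is over $e_1,\dots,e_N,\xi_{1,1},\dots,\xi_{N,m}$. -/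

import Mathlib

open MeasureTheory ProbabilityTheory
open scoped RealInnerProductSpace

noncomputable section

namespace ARDD

/-- Euclidean space `ℝⁿ`. -/
abbrev E (n : ℕ) : Type := EuclideanSpace ℝ (Fin n)

/-- The Euclidean unit sphere `S₂(1)` of `ℝⁿ`. -/
abbrev S (n : ℕ) : Type := Metric.sphere (0 : E n) 1

/-- The uniform distribution `RS₂(1)` on the Euclidean unit sphere: normalized surface measure. -/
def unifSphere (n : ℕ) : Measure (S n) :=
  ((volume : Measure (E n)).toSphere Set.univ)⁻¹ • (volume : Measure (E n)).toSphere

/-- The norm `‖x‖_p = (∑ |x_i|^p)^{1/p}` on `ℝⁿ`, for real `p ≥ 1`. -/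
def pnorm {n : ℕ} (p : ℝ) (x : E n) : ℝ := (∑ i, |x i| ^ p) ^ (1 / p)

/-- `ρ_n = min {q - 1, 16 ln n - 8} · n^{2/q - 1}` with `1/p + 1/q = 1`; for `p = 1`, that is
`q = ∞`, this reads `(16 ln n - 8) · n^{-1}`. -/
def rho (p : ℝ) (n : ℕ) : ℝ :=
  if p = 1 then (16 * Real.log n - 8) * (n : ℝ)⁻¹
  else min (p / (p - 1) - 1) (16 * Real.log n - 8) * (n : ℝ) ^ (2 / (p / (p - 1)) - 1)

/-- `d` is a (differentiable) prox-function: convex and 1-strongly convex with respect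
to `‖·‖_p`. -/
structure IsProxFunction {n : ℕ} (p : ℝ) (d : E n → ℝ) : Prop where
  differentiable : Differentiable ℝ d
  convex : ConvexOn ℝ Set.univ d
  strongly_convex : ∀ x y : E n,
    (1 / 2) * pnorm p (y - x) ^ 2 ≤ d y - d x - ⟪gradient d x, y - x⟫

/-- The Bregman divergence `V[z](x)` of `d`. -/
def bregman {n : ℕ} (d : E n → ℝ) (z x : E n) : ℝ :=
  d x - d z - ⟪gradient d z, x - z⟫

/-- The objective `f(x) = E_ξ F(x, ξ)`. -/
def objective {n : ℕ} {X : Type*} [MeasurableSpace X] (P : Measure X) (F : E n → X → ℝ)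
    (x : E n) : ℝ := ∫ s, F x s ∂P

/-- The noisy directional derivative `⟨g(x, ξ), e⟩ + ζ(x, ξ, e) + η(x, ξ, e)`. -/
def noisyDeriv {n : ℕ} {X : Type*} (g : E n → X → E n) (ζ η : E n → X → S n → ℝ)
    (x : E n) (s : X) (e : S n) : ℝ := ⟪g x s, (e : E n)⟫ + ζ x s e + η x s e

/-- The mini-batch estimate `(1/m) ∑ f'(x, ξ_i, e) e` of the gradient, where `f'` is the
oracle `D`. -/
def gradEst {n m : ℕ} {X : Type*} (D : E n → X → S n → ℝ)
    (x : E n) (s : Fin m → X) (e : S n) : E n :=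
  (1 / (m : ℝ)) • ∑ i, D x (s i) e • (e : E n)

/-- A minimizer of `h` over `ℝⁿ` (an arbitrary point if there is none). -/
def argmin {n : ℕ} (h : E n → ℝ) : E n := Classical.epsilon fun z => ∀ w, h z ≤ h w

/-- Step size `α_{k+1} = (k + 2) / (96 n² ρ_n L₂)`. -/
def alpha (n : ℕ) (p L₂ : ℝ) (k : ℕ) : ℝ :=
  ((k : ℝ) + 2) / (96 * (n : ℝ) ^ 2 * rho p n * L₂)

/-- Mixing weight `τ_k = 2 / (k + 2)`. -/
def tau (k : ℕ) : ℝ := 2 / ((k : ℝ) + 2)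

/-- The pair `(y_k, z_k)` produced by the method. -/
structure State (n : ℕ) where
  y : E n
  z : E n

/-- The extrapolation point `x_{k+1} = τ_k z_k + (1 - τ_k) y_k`. -/
def State.x {n : ℕ} (st : State n) (k : ℕ) : E n := tau k • st.z + (1 - tau k) • st.y

/-- Iteration `k` of the method: from `(y_k, z_k)`, the fresh direction `e = e_{k+1}` and the
fresh batch `s = (ξ_{k+1,1}, …, ξ_{k+1,m})`, to `(y_{k+1}, z_{k+1})`. -/
def step {n m : ℕ} {X : Type*} (p L₂ : ℝ) (d : E n → ℝ) (D : E n → X → S n → ℝ)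
    (k : ℕ) (e : S n) (s : Fin m → X) (st : State n) : State n where
  y := st.x k - (1 / (2 * L₂)) • gradEst D (st.x k) s e
  z := argmin fun z =>
    alpha n p L₂ k * n * ⟪gradEst D (st.x k) s e, z - st.z⟫ + bregman d st.z z

/-- The state `(y_k, z_k)` after `k` iterations, started at `y_0 = z_0 = x₀`; iteration `k`
uses the direction `e k` and the batch `s k`. -/
def run {n m : ℕ} {X : Type*} (p L₂ : ℝ) (d : E n → ℝ) (D : E n → X → S n → ℝ) (x₀ : E n)
    (e : ℕ → S n) (s : ℕ → Fin m → X) : ℕ → State n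
  | 0 => ⟨x₀, x₀⟩
  | k + 1 => step p L₂ d D k (e k) (s k) (run p L₂ d D x₀ e s k)

end ARDD

end

/-! The method couples a gradient step with a mirror step. It is analysed through the potential `w_k
(f(y) - f(x*)) + V[z](x*)`, where `w_k = α_{k+1} / τ_k`. Along a unit direction `e`, put `a =
⟨∇f(x), e⟩`. The descent step gains `a² / (4 L₂)` up to errors (`descent_step`). The mirror step
costs `c² t² R(e) / 2`, where `t` is the averaged observed derivative, `c = α n`, and `√R` dominates
the norm dual to `‖·‖_p` (`bregman_mirror_step`). Averaging over `e` turns `a²` into `‖∇f‖² / n` and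
`a² R(e)` into `(‖∇f‖² / n) E R`. Both are exact, because `R` is invariant under signed coordinate
permutations (`integral_coord_mul_coord`). Gaussian moments and Jensen give `E R ≤ 12 ρ_n`
(`exists_symmetric_dual_bound`), and the step sizes are tuned so that the gain then absorbs the
cost. Convexity (`coupling_step`) turns what remains into the recursion step `one_step_fixed_state`.

The noise may be biased, so each step leaves a drift proportional to `‖x* - z_k‖ ≤ √(2V)`. Young's
inequality with a free parameter keeps the recursion linear in the expected potential. A good choice
of parameters bounds the final potential by twice the initial potential plus accumulated variance,
plus the square of the summed drifts (`recursion_bound`). Dividing by the last weight gives the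
rate.

Expectations are lower integrals of nonnegative quantities, so integrability of `f(y_N)` is a
by-product. Independence enters only through `lintegral_run_succ`, which freezes the past and
integrates out the fresh samples. -/

noncomputable section

namespace ARDD

/-! ### The uniform distribution on the sphere -/

/-- The map of the unit sphere induced by a linear isometry. -/
def sphereMap {n : ℕ} (A : E n ≃ₗᵢ[ℝ] E n) (e : S n) : S n :=
  ⟨A e, by simp⟩

lemma measurable_sphereMap {n : ℕ} (A : E n ≃ₗᵢ[ℝ] E n) : Measurable (sphereMap A) :=
  (A.continuous.measurable.comp measurable_subtype_coe).subtype_mk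

/-- Surface measure is, up to a constant, the volume of the cone over a set. A linear isometry maps
cones to cones and preserves volume. -/
lemma measurePreserving_sphereMap_toSphere {n : ℕ} (A : E n ≃ₗᵢ[ℝ] E n) :
    MeasurePreserving (sphereMap A) (volume : Measure (E n)).toSphere
      (volume : Measure (E n)).toSphere := by
  refine ⟨measurable_sphereMap A, ?_⟩
  ext s hs
  rw [Measure.map_apply (measurable_sphereMap A) hs, Measure.toSphere_apply' _ hs,
    Measure.toSphere_apply' _ (measurable_sphereMap A hs)]
  congr 1
  symm
  rw [← A.measurePreserving.measure_preimage_emb A.toHomeomorph.measurableEmbedding]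
  congr 1
  ext x
  simp only [Set.mem_smul, Set.mem_image, Set.mem_preimage]
  constructor
  · rintro ⟨r, hr, _, ⟨e, he, rfl⟩, h⟩
    refine ⟨r, hr, A.symm e, ⟨⟨A.symm e, by simp⟩, ?_, rfl⟩, ?_⟩
    · simpa [sphereMap] using he
    · apply A.injective
      simpa using h
  · rintro ⟨r, hr, _, ⟨e, he, rfl⟩, rfl⟩
    exact ⟨r, hr, _, ⟨sphereMap A e, he, rfl⟩, by simp [sphereMap]⟩

lemma measurePreserving_sphereMap {n : ℕ} (A : E n ≃ₗᵢ[ℝ] E n) :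
    MeasurePreserving (sphereMap A) (unifSphere n) (unifSphere n) :=
  (measurePreserving_sphereMap_toSphere A).smul_measure _

lemma isProbabilityMeasure_unifSphere {n : ℕ} (hn : 2 ≤ n) :
    IsProbabilityMeasure (unifSphere n) := by
  have : Nonempty (Fin n) := ⟨⟨0, by omega⟩⟩
  constructor
  simp only [unifSphere, Measure.smul_apply, smul_eq_mul]
  refine ENNReal.inv_mul_cancel ?_ (measure_ne_top _ _)
  rw [Measure.measure_univ_ne_zero]
  exact Measure.toSphere_ne_zero _

/-! ### Even moments of a coordinate on the sphere, through Gaussian integrals -/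

lemma integral_polar {n : ℕ} (hn : 2 ≤ n) (H : E n → ℝ) (h : S n → ℝ) (φ : ℝ → ℝ)
    (hH : ∀ (e : S n) (r : ℝ), 0 < r → H (r • (e : E n)) = h e * φ r) :
    ∫ x, H x = (∫ e, h e ∂(volume : Measure (E n)).toSphere) *
      ∫ y in Set.Ioi (0 : ℝ), y ^ (n - 1) * φ y := by
  have : Nonempty (Fin n) := ⟨⟨0, by omega⟩⟩
  have hdim : Module.finrank ℝ (E n) = n := by simp
  calc
    ∫ x, H x = ∫ x : ({(0)}ᶜ : Set (E n)), H x ∂((volume : Measure (E n)).comap (↑)) := by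
      rw [integral_subtype_comap (measurableSet_singleton _).compl fun x ↦ H x,
        restrict_compl_singleton]
    _ = ∫ x, h x.1 * φ x.2 ∂(volume : Measure (E n)).toSphere.prod (.volumeIoiPow (n - 1)) := by
      have := (volume : Measure (E n)).measurePreserving_homeomorphUnitSphereProd.integral_comp
        (Homeomorph.measurableEmbedding _) (fun x => h x.1 * φ x.2)
      rw [hdim] at this
      rw [← this]
      congr 1
      ext x
      have hx : 0 < ‖(x : E n)‖ := norm_pos_iff.2 x.2
      rw [← hH _ _ (by simpa using hx)]
      congr 1
      simp [smul_smul, hx.ne']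
    _ = _ := by
      rw [integral_prod_mul (f := h) (g := fun x : Set.Ioi (0 : ℝ) => φ x)]
      congr 1
      simp only [Measure.volumeIoiPow, ENNReal.ofReal]
      rw [integral_withDensity_eq_integral_smul,
        integral_subtype_comap measurableSet_Ioi fun a ↦ Real.toNNReal (a ^ (n - 1)) • φ a,
        setIntegral_congr_fun measurableSet_Ioi fun x hx ↦ ?_]
      · rw [NNReal.smul_def, Real.coe_toNNReal _ (pow_nonneg hx.out.le _), smul_eq_mul]
      · exact (measurable_subtype_coe.pow_const _).real_toNNReal

lemma integral_pow_mul_exp_neg_sq (j : ℕ) :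
    ∫ y in Set.Ioi (0 : ℝ), y ^ j * Real.exp (-y ^ 2) = Real.Gamma ((j + 1) / 2) / 2 := by
  have := integral_rpow_mul_exp_neg_rpow (p := 2) (q := j) (by norm_num)
    (by have : (0 : ℝ) ≤ j := j.cast_nonneg
        linarith)
  simp only [Real.rpow_natCast, Real.rpow_ofNat] at this
  rw [this]
  ring

lemma integral_even_pow_mul_exp_neg_sq (k : ℕ) :
    ∫ y : ℝ, y ^ (2 * k) * Real.exp (-y ^ 2) = Real.Gamma (k + 1 / 2) := by
  have := integral_comp_abs (f := fun y => y ^ (2 * k) * Real.exp (-y ^ 2))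
  simp only [pow_mul, sq_abs] at this
  simp only [pow_mul]
  rw [this]
  have h2 := integral_pow_mul_exp_neg_sq (2 * k)
  simp only [pow_mul] at h2
  rw [h2]
  push_cast
  rw [show ((2 : ℝ) * k + 1) / 2 = k + 1 / 2 by ring]
  ring

lemma integral_coord_pow_mul_exp {n : ℕ} (i : Fin n) (k : ℕ) :
    ∫ x : E n, (x i) ^ (2 * k) * Real.exp (-‖x‖ ^ 2) =
      Real.Gamma (k + 1 / 2) * Real.Gamma (1 / 2) ^ (n - 1) := by
  have h1 := (PiLp.volume_preserving_toLp (Fin n)).integral_comp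
    (MeasurableEquiv.toLp 2 (Fin n → ℝ)).measurableEmbedding
    (fun x : E n => (x i) ^ (2 * k) * Real.exp (-‖x‖ ^ 2))
  rw [← h1]
  have h2 := integral_fintype_prod_volume_eq_prod (ι := Fin n) (𝕜 := ℝ) (E := fun _ => ℝ)
    (fun j y => y ^ (2 * (if j = i then k else 0)) * Real.exp (-y ^ 2))
  have h3 : ∀ x : Fin n → ℝ, ∏ j, (x j ^ (2 * (if j = i then k else 0)) * Real.exp (-x j ^ 2))
      = (x i) ^ (2 * k) * Real.exp (-‖(WithLp.toLp 2 x : E n)‖ ^ 2) := by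
    intro x
    rw [Finset.prod_mul_distrib, EuclideanSpace.real_norm_sq_eq, ← Finset.sum_neg_distrib,
      Real.exp_sum]
    congr 1
    rw [Finset.prod_eq_single i]
    · simp
    · intro j _ hj
      simp [hj]
    · simp
  simp only [h3] at h2
  simp only [integral_even_pow_mul_exp_neg_sq] at h2
  rw [h2, ← Finset.mul_prod_erase _ _ (Finset.mem_univ i)]
  congr 1
  · simp
  · rw [Finset.prod_congr rfl (g := fun _ => Real.Gamma (1 / 2))]
    · simp [Finset.card_erase_of_mem]
    · intro j hj
      simp [Finset.ne_of_mem_erase hj]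

/-- The Gaussian integral of `x_i ^ (2k)` is computed twice: as a product of one-dimensional
integrals and in polar coordinates. -/
lemma integral_coord_pow_toSphere {n : ℕ} (hn : 2 ≤ n) (i : Fin n) (k : ℕ) :
    (∫ e : S n, ((e : E n) i) ^ (2 * k) ∂(volume : Measure (E n)).toSphere) *
      (Real.Gamma (n / 2 + k) / 2) = Real.Gamma (k + 1 / 2) * Real.Gamma (1 / 2) ^ (n - 1) := by
  rw [← integral_coord_pow_mul_exp i k, integral_polar hn
    (fun x : E n => (x i) ^ (2 * k) * Real.exp (-‖x‖ ^ 2))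
    (fun e => ((e : E n) i) ^ (2 * k)) (fun y => y ^ (2 * k) * Real.exp (-y ^ 2))]
  · congr 1
    simp only [← mul_assoc, ← pow_add]
    rw [integral_pow_mul_exp_neg_sq]
    congr 2
    have : 1 ≤ n := by omega
    push_cast [this]
    ring
  · intro e r hr
    simp [norm_smul, mul_pow, abs_of_pos hr]
    ring

lemma two_mul_add_one_mul_pow_self_le (k : ℕ) :
    (2 * (k : ℝ) + 1) * (k : ℝ) ^ k ≤ ((k : ℝ) + 1) ^ (k + 1) := by
  rcases Nat.eq_zero_or_pos k with rfl | hk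
  · simp
  have hk0 : (0 : ℝ) < k := by positivity
  have hB := one_add_mul_le_pow (a := 1 / (k : ℝ)) (by linarith [one_div_pos.2 hk0]) k
  have h2 : 2 * (k : ℝ) ^ k ≤ ((k : ℝ) + 1) ^ k := by
    calc 2 * (k : ℝ) ^ k = (1 + k * (1 / (k : ℝ))) * (k : ℝ) ^ k := by field_simp; ring
      _ ≤ (1 + 1 / (k : ℝ)) ^ k * (k : ℝ) ^ k := by gcongr
      _ = ((k : ℝ) + 1) ^ k := by rw [← mul_pow]; congr 1; field_simp
  have h3 : (0 : ℝ) ≤ (k : ℝ) ^ k := by positivity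
  rw [pow_succ]
  nlinarith

/-- Up to normalization this bounds the `2k`-th moment of a coordinate. Passing from `k` to `k + 1`
multiplies the moment by `(k + 1/2) / (n/2 + k)`. After replacing `n/2 + k` by `n/2`, Bernoulli's
inequality suffices. -/
lemma Gamma_ratio_le {n : ℕ} (hn : 2 ≤ n) (k : ℕ) :
    Real.Gamma (k + 1 / 2) * Real.Gamma (n / 2) ≤
      ((k : ℝ) / n) ^ k * (Real.Gamma (1 / 2) * Real.Gamma (n / 2 + k)) := by
  have hn0 : (0 : ℝ) < n := by positivity
  induction k with
  | zero => simp
  | succ k ih =>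
    have hG2 : 0 < Real.Gamma (n / 2 + k) := Real.Gamma_pos_of_pos (by positivity)
    have hG3 : 0 < Real.Gamma (1 / 2) := Real.Gamma_pos_of_pos (by positivity)
    have e1 : Real.Gamma ((k + 1 : ℕ) + 1 / 2) = (k + 1 / 2) * Real.Gamma (k + 1 / 2) := by
      rw [← Real.Gamma_add_one (by positivity)]; congr 1; push_cast; ring
    have e2 : Real.Gamma (n / 2 + (k + 1 : ℕ)) = (n / 2 + k) * Real.Gamma (n / 2 + k) := by
      rw [← Real.Gamma_add_one (by positivity)]; congr 1; push_cast; ring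
    rw [e1, e2]
    have key : ((k : ℝ) + 1 / 2) * (k / n) ^ k ≤ (((k + 1 : ℕ) : ℝ) / n) ^ (k + 1) * (n / 2 + k) := by
      calc ((k : ℝ) + 1 / 2) * (k / n) ^ k
          = ((2 * (k : ℝ) + 1) * (k : ℝ) ^ k) / (n : ℝ) ^ (k + 1) * (n / 2) := by
            rw [div_pow, pow_succ]; field_simp
        _ ≤ ((k : ℝ) + 1) ^ (k + 1) / (n : ℝ) ^ (k + 1) * (n / 2 + k) := by
            gcongr
            · exact two_mul_add_one_mul_pow_self_le k
            · simp
        _ = _ := by rw [div_pow]; push_cast; rfl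
    calc (k + 1 / 2) * Real.Gamma (k + 1 / 2) * Real.Gamma (n / 2)
        = (k + 1 / 2) * (Real.Gamma (k + 1 / 2) * Real.Gamma (n / 2)) := by ring
      _ ≤ (k + 1 / 2) * (((k : ℝ) / n) ^ k * (Real.Gamma (1 / 2) * Real.Gamma (n / 2 + k))) := by
          gcongr
      _ = ((k : ℝ) + 1 / 2) * (k / n) ^ k * (Real.Gamma (1 / 2) * Real.Gamma (n / 2 + k)) := by ring
      _ ≤ (((k + 1 : ℕ) : ℝ) / n) ^ (k + 1) * (n / 2 + k) *
          (Real.Gamma (1 / 2) * Real.Gamma (n / 2 + k)) := by gcongr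
      _ = _ := by ring

lemma integral_coord_pow_le {n : ℕ} (hn : 2 ≤ n) (i : Fin n) (k : ℕ) :
    ∫ e : S n, ((e : E n) i) ^ (2 * k) ∂(unifSphere n) ≤ ((k : ℝ) / n) ^ k := by
  -- The case `k = 0` is the total surface mass, which normalizes the moment.
  have h0 := integral_coord_pow_toSphere hn i 0
  have h1 := integral_coord_pow_toSphere hn i k
  simp only [mul_zero, pow_zero, integral_const, smul_eq_mul, mul_one, Nat.cast_zero, add_zero,
    zero_add] at h0
  have hg := Gamma_ratio_le hn k
  rw [unifSphere, integral_smul_measure]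
  set M := ∫ e : S n, ((e : E n) i) ^ (2 * k) ∂(volume : Measure (E n)).toSphere
  have hv : (((volume : Measure (E n)).toSphere Set.univ)⁻¹).toReal =
    ((volume : Measure (E n)).toSphere.real Set.univ)⁻¹ := by
    rw [ENNReal.toReal_inv]; rfl
  rw [hv]
  set A := (volume : Measure (E n)).toSphere.real Set.univ
  have hn0 : (0 : ℝ) < n := by positivity
  have hG1 : 0 < Real.Gamma (n / 2) := Real.Gamma_pos_of_pos (by positivity)
  have hG2 : 0 < Real.Gamma (n / 2 + k) := Real.Gamma_pos_of_pos (by positivity)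
  have hG3 : 0 < Real.Gamma (1 / 2) := Real.Gamma_pos_of_pos (by positivity)
  have hA : 0 < A := by
    have : 0 < A * (Real.Gamma (n / 2) / 2) := by rw [h0]; positivity
    exact pos_of_mul_pos_left this (by positivity)
  rw [smul_eq_mul, inv_mul_le_iff₀ hA]
  have hP : 0 < Real.Gamma (n / 2) * Real.Gamma (n / 2 + k) := by positivity
  refine le_of_mul_le_mul_right ?_ hP
  calc M * (Real.Gamma (n / 2) * Real.Gamma (n / 2 + k))
      = 2 * Real.Gamma (n / 2) * (M * (Real.Gamma (n / 2 + k) / 2)) := by ring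
    _ = 2 * Real.Gamma (1 / 2) ^ (n - 1) * (Real.Gamma (k + 1 / 2) * Real.Gamma (n / 2)) := by
        rw [h1]; ring
    _ ≤ 2 * Real.Gamma (1 / 2) ^ (n - 1) *
        (((k : ℝ) / n) ^ k * (Real.Gamma (1 / 2) * Real.Gamma (n / 2 + k))) := by gcongr
    _ = 2 * ((k : ℝ) / n) ^ k * Real.Gamma (n / 2 + k) *
        (Real.Gamma (1 / 2) * Real.Gamma (1 / 2) ^ (n - 1)) := by ring
    _ = _ := by rw [← h0]; ring

/-! ### The norms `‖·‖_p` -/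

lemma pnorm_nonneg {n : ℕ} (p : ℝ) (x : E n) : 0 ≤ pnorm p x := by
  unfold pnorm; positivity

lemma sum_rpow_le_rpow_sum {ι : Type*} (s : Finset ι) (a : ι → ℝ) (ha : ∀ i, 0 ≤ a i) {r : ℝ}
    (hr : 1 ≤ r) : ∑ i ∈ s, a i ^ r ≤ (∑ i ∈ s, a i) ^ r := by
  classical
  induction s using Finset.induction_on with
  | empty => simp [Real.zero_rpow (by linarith : r ≠ 0)]
  | insert i s hi ih =>
    rw [Finset.sum_insert hi, Finset.sum_insert hi]
    calc a i ^ r + ∑ i ∈ s, a i ^ r ≤ a i ^ r + (∑ i ∈ s, a i) ^ r := by gcongr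
      _ ≤ _ := Real.add_rpow_le_rpow_add (ha i) (Finset.sum_nonneg fun i _ => ha i) hr

lemma pnorm_anti {n : ℕ} {p r : ℝ} (hp : 1 ≤ p) (hr : p ≤ r) (x : E n) :
    pnorm r x ≤ pnorm p x := by
  have hp0 : 0 < p := by linarith
  have hr0 : 0 < r := by linarith
  have h := sum_rpow_le_rpow_sum Finset.univ (fun i => |x i| ^ p) (fun i => by positivity)
    ((one_le_div hp0).2 hr)
  simp only [← Real.rpow_mul (abs_nonneg _), mul_div_cancel₀ r hp0.ne'] at h
  unfold pnorm
  calc (∑ i, |x i| ^ r) ^ (1 / r) ≤ ((∑ i, |x i| ^ p) ^ (r / p)) ^ (1 / r) := by gcongr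
    _ = _ := by
      rw [← Real.rpow_mul (by positivity)]
      congr 1
      field_simp

lemma pnorm_two {n : ℕ} (x : E n) : pnorm 2 x = ‖x‖ := by
  rw [EuclideanSpace.norm_eq, Real.sqrt_eq_rpow, pnorm]
  simp

lemma norm_le_pnorm {n : ℕ} {p : ℝ} (hp₁ : 1 ≤ p) (hp₂ : p ≤ 2) (x : E n) : ‖x‖ ≤ pnorm p x := by
  rw [← pnorm_two]
  exact pnorm_anti hp₁ hp₂ x

lemma pnorm_le_card_mul_pnorm {n : ℕ} {q r : ℝ} (hq : 1 ≤ q) (hr : q ≤ r) (x : E n) :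
    pnorm q x ≤ (n : ℝ) ^ (1 / q - 1 / r) * pnorm r x := by
  have hq0 : 0 < q := by linarith
  have hr0 : 0 < r := by linarith
  have h := Real.rpow_sum_le_const_mul_sum_rpow_of_nonneg Finset.univ ((one_le_div hq0).2 hr)
    (f := fun i => |x i| ^ q) (fun i _ => by positivity)
  simp only [← Real.rpow_mul (abs_nonneg _), mul_div_cancel₀ r hq0.ne', Finset.card_univ,
    Fintype.card_fin] at h
  unfold pnorm
  calc (∑ i, |x i| ^ q) ^ (1 / q) = ((∑ i, |x i| ^ q) ^ (r / q)) ^ (1 / r) := by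
        rw [← Real.rpow_mul (by positivity)]
        congr 1
        field_simp
    _ ≤ ((n : ℝ) ^ (r / q - 1) * ∑ i, |x i| ^ r) ^ (1 / r) := by gcongr
    _ = _ := by
      rw [Real.mul_rpow (by positivity) (by positivity), ← Real.rpow_mul (by positivity)]
      congr 2
      field_simp

lemma abs_inner_le_pnorm_mul_pnorm {n : ℕ} {p q : ℝ} (h : q.HolderConjugate p) (x y : E n) :
    |⟪x, y⟫| ≤ pnorm q x * pnorm p y := by
  have h1 := Real.inner_le_Lp_mul_Lq Finset.univ (fun i => |x i|) (fun i => |y i|) h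
  simp only [abs_abs] at h1
  refine le_trans ?_ h1
  simp only [PiLp.inner_apply, RCLike.inner_apply, conj_trivial]
  refine (Finset.abs_sum_le_sum_abs _ _).trans_eq (Finset.sum_congr rfl fun i _ => ?_)
  rw [abs_mul, mul_comm]

lemma continuous_pnorm {n : ℕ} {p : ℝ} (hp : 1 ≤ p) : Continuous (pnorm p : E n → ℝ) := by
  have hp0 : 0 < p := by linarith
  unfold pnorm
  refine Continuous.rpow_const (continuous_finsetSum _ fun i _ => ?_) fun x => Or.inr (by positivity)
  exact Continuous.rpow_const (by fun_prop) fun x => Or.inr hp0.le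

/-! ### Symmetric functions on the sphere -/

/-- Sign change of one coordinate. -/
def flipCoord {n : ℕ} (i : Fin n) : E n ≃ₗᵢ[ℝ] E n :=
  LinearIsometryEquiv.piLpCongrRight 2
    (fun j => if j = i then LinearIsometryEquiv.neg ℝ else LinearIsometryEquiv.refl ℝ ℝ)

/-- Permutation of the coordinates. -/
def permCoord {n : ℕ} (π : Equiv.Perm (Fin n)) : E n ≃ₗᵢ[ℝ] E n :=
  LinearIsometryEquiv.piLpCongrLeft 2 ℝ ℝ π

lemma flipCoord_apply {n : ℕ} (i j : Fin n) (x : E n) :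
    flipCoord i x j = if j = i then -x j else x j := by
  unfold flipCoord
  rw [LinearIsometryEquiv.piLpCongrRight_apply]
  change (if j = i then LinearIsometryEquiv.neg ℝ else LinearIsometryEquiv.refl ℝ ℝ) (x j) = _
  split_ifs <;> simp

lemma permCoord_apply {n : ℕ} (π : Equiv.Perm (Fin n)) (j : Fin n) (x : E n) :
    permCoord π x j = x (π.symm j) := by
  unfold permCoord
  rw [LinearIsometryEquiv.piLpCongrLeft_apply]
  simp [Equiv.piCongrLeft']

/-- A function on `ℝⁿ` is symmetric if it is invariant under permutations and sign changes of the
coordinates. -/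
structure IsSymmetric {n : ℕ} (R : E n → ℝ) : Prop where
  flip : ∀ i x, R (flipCoord i x) = R x
  perm : ∀ π x, R (permCoord π x) = R x

lemma isSymmetric_pnorm {n : ℕ} (p : ℝ) : IsSymmetric (pnorm p : E n → ℝ) where
  flip i x := by
    unfold pnorm
    congr 1
    refine Finset.sum_congr rfl fun j _ => ?_
    rw [flipCoord_apply]
    split_ifs <;> simp
  perm π x := by
    unfold pnorm
    congr 1
    simp only [permCoord_apply]
    exact Equiv.sum_comp π.symm (fun j => |x j| ^ p)

lemma continuous_integrable_unifSphere {n : ℕ} (hn : 2 ≤ n) {h : S n → ℝ} (hh : Continuous h) :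
    Integrable h (unifSphere n) := by
  have := isProbabilityMeasure_unifSphere hn
  rw [← integrableOn_univ]
  exact hh.continuousOn.integrableOn_compact isCompact_univ

lemma integral_comp_sphereMap {n : ℕ} (A : E n ≃ₗᵢ[ℝ] E n) {h : S n → ℝ} (hh : Continuous h) :
    ∫ e, h (sphereMap A e) ∂(unifSphere n) = ∫ e, h e ∂(unifSphere n) := by
  have hA := measurePreserving_sphereMap A
  conv_rhs => rw [← hA.map_eq]
  rw [integral_map hA.measurable.aemeasurable hh.aestronglyMeasurable]

/-- Sign flips kill the off-diagonal entries, swaps make the diagonal entries equal, and `∑ e_j² =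
1` fixes the trace. Being exact, this avoids any Cauchy–Schwarz estimate with fourth moments. -/
lemma integral_coord_mul_coord {n : ℕ} (hn : 2 ≤ n) {R : E n → ℝ} (hR : Continuous R)
    (hs : IsSymmetric R) (i j : Fin n) :
    ∫ e : S n, (e : E n) i * (e : E n) j * R e ∂(unifSphere n) =
      if i = j then (∫ e : S n, R e ∂(unifSphere n)) / n else 0 := by
  have hn0 : (n : ℝ) ≠ 0 := by positivity
  have hcont : ∀ i j : Fin n, Continuous fun e : S n => (e : E n) i * (e : E n) j * R e := by
    intro i j
    fun_prop
  split_ifs with hij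
  · subst hij
    have h1 : ∀ j, ∫ e : S n, (e : E n) j * (e : E n) j * R e ∂(unifSphere n) =
        ∫ e : S n, (e : E n) i * (e : E n) i * R e ∂(unifSphere n) := by
      intro j
      rw [← integral_comp_sphereMap (permCoord (Equiv.swap i j)) (hcont j j)]
      simp [sphereMap, permCoord_apply, hs.perm]
    have h2 : ∑ j, ∫ e : S n, (e : E n) j * (e : E n) j * R e ∂(unifSphere n) =
        ∫ e : S n, R e ∂(unifSphere n) := by
      rw [← integral_finsetSum _ fun j _ => continuous_integrable_unifSphere hn (hcont j j)]
      congr 1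
      ext e
      rw [← Finset.sum_mul]
      have : ∑ j, (e : E n) j * (e : E n) j = 1 := by
        have h := EuclideanSpace.real_norm_sq_eq (e : E n)
        rw [show ‖(e : E n)‖ = 1 by simp] at h
        simp only [← sq]
        linarith
      rw [this, one_mul]
    rw [Finset.sum_congr rfl fun j _ => h1 j] at h2
    simp only [Finset.sum_const, Finset.card_univ, Fintype.card_fin, nsmul_eq_mul] at h2
    rw [← h2]
    field_simp
  · have h := integral_comp_sphereMap (flipCoord i) (hcont i j)
    simp only [sphereMap, flipCoord_apply, hs.flip, if_true, if_neg (Ne.symm hij), neg_mul,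
      integral_neg] at h
    linarith

lemma integral_inner_mul_inner {n : ℕ} (hn : 2 ≤ n) {R : E n → ℝ} (hR : Continuous R)
    (hs : IsSymmetric R) (v w : E n) :
    ∫ e : S n, ⟪v, (e : E n)⟫ * ⟪w, (e : E n)⟫ * R e ∂(unifSphere n) =
      ⟪v, w⟫ / n * ∫ e : S n, R e ∂(unifSphere n) := by
  have h1 : ∀ e : S n, ⟪v, (e : E n)⟫ * ⟪w, (e : E n)⟫ * R e =
      ∑ i, ∑ j, v i * w j * ((e : E n) i * (e : E n) j * R e) := by
    intro e
    simp only [PiLp.inner_apply, RCLike.inner_apply, conj_trivial]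
    rw [Finset.sum_mul_sum, Finset.sum_mul]
    refine Finset.sum_congr rfl fun i _ => ?_
    rw [Finset.sum_mul]
    refine Finset.sum_congr rfl fun j _ => ?_
    ring
  simp only [h1]
  have hcont : ∀ i j : Fin n, Continuous fun e : S n =>
      v i * w j * ((e : E n) i * (e : E n) j * R e) := by
    intro i j
    fun_prop
  rw [integral_finsetSum _ fun i _ => continuous_integrable_unifSphere hn
    (continuous_finsetSum _ fun j _ => hcont i j)]
  simp only [PiLp.inner_apply, RCLike.inner_apply, conj_trivial]
  rw [Finset.sum_div, Finset.sum_mul]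
  refine Finset.sum_congr rfl fun i _ => ?_
  rw [integral_finsetSum _ fun j _ => continuous_integrable_unifSphere hn (hcont i j)]
  simp only [integral_const_mul, integral_coord_mul_coord hn hR hs]
  simp
  ring

lemma integral_inner_mul_inner_one {n : ℕ} (hn : 2 ≤ n) (v w : E n) :
    ∫ e : S n, ⟪v, (e : E n)⟫ * ⟪w, (e : E n)⟫ ∂(unifSphere n) = ⟪v, w⟫ / n := by
  have := isProbabilityMeasure_unifSphere hn
  have h := integral_inner_mul_inner hn (R := fun _ => 1) continuous_const ⟨by simp, by simp⟩ v w
  simpa using h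

/-! ### The mean of the squared dual norm on the sphere -/

/-- Jensen for the concave map `t ↦ t^(1/k)` applied to `∑ e_i^(2k)`, whose mean is at most `n
(k/n)^k`. Even integer exponents are used because their moments are explicit. -/
lemma integral_pnorm_sq_le {n : ℕ} (hn : 2 ≤ n) (k : ℕ) (hk : 1 ≤ k) :
    ∫ e : S n, pnorm (2 * k) (e : E n) ^ 2 ∂(unifSphere n) ≤ k * (n : ℝ) ^ (1 / (k : ℝ) - 1) := by
  have := isProbabilityMeasure_unifSphere hn
  have hk0 : (0 : ℝ) < k := by positivity
  have hn0 : (0 : ℝ) < n := by positivity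
  have hk1 : (1 : ℝ) ≤ k := by exact_mod_cast hk
  have h1 : ∀ e : S n, pnorm (2 * k) (e : E n) ^ 2 = (∑ i, (e : E n) i ^ (2 * k)) ^ (1 / (k : ℝ)) := by
    intro e
    unfold pnorm
    rw [← Real.rpow_natCast, ← Real.rpow_mul (by positivity)]
    congr 1
    · refine Finset.sum_congr rfl fun i _ => ?_
      rw [show (2 : ℝ) * k = ((2 * k : ℕ) : ℝ) by push_cast; rfl, Real.rpow_natCast, pow_mul,
        sq_abs, pow_mul]
    · push_cast
      field_simp
  have hc1 : Continuous fun e : S n => ∑ i, (e : E n) i ^ (2 * k) := by fun_prop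
  have h0 : ∀ e : S n, 0 ≤ ∑ i, (e : E n) i ^ (2 * k) := fun e =>
    Finset.sum_nonneg fun i _ => by rw [pow_mul]; positivity
  have hc2 : Continuous fun e : S n => (∑ i, (e : E n) i ^ (2 * k)) ^ (1 / (k : ℝ)) :=
    hc1.rpow_const fun e => Or.inr (by positivity)
  have hkle : 1 / (k : ℝ) ≤ 1 := by rw [div_le_one hk0]; exact hk1
  have hJ := (Real.concaveOn_rpow (p := 1 / (k : ℝ)) (by positivity) hkle).le_map_integral
    (μ := unifSphere n) (f := fun e : S n => ∑ i, (e : E n) i ^ (2 * k))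
    (continuousOn_id.rpow_const fun x _ => Or.inr (by positivity)) isClosed_Ici
    (Filter.Eventually.of_forall h0) (continuous_integrable_unifSphere hn hc1)
    (continuous_integrable_unifSphere hn hc2)
  simp only [h1]
  refine hJ.trans ?_
  have hsum : ∫ e : S n, ∑ i, (e : E n) i ^ (2 * k) ∂(unifSphere n) ≤ n * ((k : ℝ) / n) ^ k := by
    rw [integral_finsetSum _ fun i _ => continuous_integrable_unifSphere hn (by fun_prop)]
    calc _ ≤ ∑ _i : Fin n, ((k : ℝ) / n) ^ k :=
          Finset.sum_le_sum fun i _ => integral_coord_pow_le hn i k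
      _ = _ := by simp
  calc _ ≤ (n * ((k : ℝ) / n) ^ k) ^ (1 / (k : ℝ)) := by
        refine Real.rpow_le_rpow (integral_nonneg h0) hsum (by positivity)
    _ = _ := by
      rw [Real.mul_rpow (by positivity) (by positivity), ← Real.rpow_natCast,
        ← Real.rpow_mul (by positivity), mul_one_div_cancel hk0.ne', Real.rpow_one,
        Real.rpow_sub hn0, Real.rpow_one]
      ring

lemma lt_log_of_two_le {n : ℕ} (hn : 2 ≤ n) : 0.69 < Real.log n := by
  have h1 : Real.log 2 ≤ Real.log n := Real.log_le_log (by norm_num) (by exact_mod_cast hn)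
  linarith [Real.log_two_gt_d9]

lemma rho_pos {n : ℕ} (hn : 2 ≤ n) {p : ℝ} (hp₁ : 1 ≤ p) : 0 < rho p n := by
  have hlog := lt_log_of_two_le hn
  have hn0 : (0 : ℝ) < n := by positivity
  unfold rho
  split_ifs with h
  · exact mul_pos (by linarith) (by positivity)
  · have hp : 0 < p - 1 := by
      rcases lt_or_eq_of_le hp₁ with h' | h'
      · linarith
      · exact absurd h'.symm h
    have : p / (p - 1) - 1 = 1 / (p - 1) := by field_simp; ring
    refine mul_pos (lt_min ?_ (by linarith)) (by positivity)
    rw [this]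
    positivity

/-- There is a symmetric function `R` such that `√(R e)` bounds the norm of `e` dual to `‖·‖_p`,
and whose mean on the sphere is at most `12 ρ_n`. -/
lemma exists_symmetric_dual_bound {n : ℕ} (hn : 2 ≤ n) {p : ℝ} (hp₁ : 1 ≤ p) (hp₂ : p ≤ 2) :
    ∃ R : E n → ℝ, Continuous R ∧ IsSymmetric R ∧ (∀ x, 0 ≤ R x) ∧
      (∀ x y, ⟪x, y⟫ ^ 2 ≤ R x * pnorm p y ^ 2) ∧
      ∫ e : S n, R e ∂(unifSphere n) ≤ 12 * rho p n := by
  have hlog := lt_log_of_two_le hn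
  have hn0 : (0 : ℝ) < n := by positivity
  have main : ∀ (c : ℝ) (k : ℕ), 1 ≤ k →
      (∀ x y : E n, |⟪x, y⟫| ≤ c * pnorm (2 * k) x * pnorm p y) →
      c ^ 2 * (k * (n : ℝ) ^ (1 / (k : ℝ) - 1)) ≤ 12 * rho p n →
      ∃ R : E n → ℝ, Continuous R ∧ IsSymmetric R ∧ (∀ x, 0 ≤ R x) ∧
      (∀ x y, ⟪x, y⟫ ^ 2 ≤ R x * pnorm p y ^ 2) ∧
      ∫ e : S n, R e ∂(unifSphere n) ≤ 12 * rho p n := by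
    intro c k hk hR hc
    have hk1 : (1 : ℝ) ≤ k := by exact_mod_cast hk
    have hcont : Continuous (pnorm (2 * k) : E n → ℝ) := continuous_pnorm (by linarith)
    have hsymm := isSymmetric_pnorm (n := n) (2 * k)
    refine ⟨fun x => c ^ 2 * pnorm (2 * k) x ^ 2, by fun_prop, ⟨?_, ?_⟩, fun x => by positivity,
      ?_, ?_⟩
    · intro i x
      simp only [hsymm.flip]
    · intro i x
      simp only [hsymm.perm]
    · intro x y
      calc ⟪x, y⟫ ^ 2 = |⟪x, y⟫| ^ 2 := (sq_abs _).symm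
        _ ≤ (c * pnorm (2 * k) x * pnorm p y) ^ 2 := by
          have := hR x y
          gcongr
        _ = _ := by ring
    · rw [integral_const_mul]
      refine le_trans ?_ hc
      have := integral_pnorm_sq_le hn k hk
      gcongr
  have hcase : (p ≠ 1 ∧ p / (p - 1) - 1 ≤ 16 * Real.log n - 8) ∨
      (p = 1 ∨ (p ≠ 1 ∧ 16 * Real.log n - 8 ≤ p / (p - 1) - 1)) := by
    by_cases h : p = 1
    · simp [h]
    · rcases le_total (p / (p - 1) - 1) (16 * Real.log n - 8) with h' | h' <;> simp [h, h']
  rcases hcase with ⟨hp, hq⟩ | hp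
  · have hp' : 1 < p := lt_of_le_of_ne hp₁ (Ne.symm hp)
    have hconj : p.HolderConjugate (p / (p - 1)) := Real.HolderConjugate.conjExponent hp'
    have hrho : rho p n = (p / (p - 1) - 1) * (n : ℝ) ^ (2 / (p / (p - 1)) - 1) := by
      rw [rho, if_neg hp, min_eq_left hq]
    set q := p / (p - 1)
    have hq2 : 2 ≤ q := by
      rw [le_div_iff₀ (by linarith)]; linarith
    -- Here `2k` is the least even integer above `q`. Passing from `‖·‖_q` to `‖·‖_{2k}` costs
    -- `n^(1/q - 1/(2k))`, which corrects the exponent `1/k - 1` to exactly `2/q - 1`.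
    have hk1 : 1 ≤ ⌈q / 2⌉₊ := Nat.one_le_ceil_iff.2 (by linarith)
    have hk2 : q / 2 ≤ ⌈q / 2⌉₊ := Nat.le_ceil _
    have hk3 : (⌈q / 2⌉₊ : ℝ) < q / 2 + 1 := Nat.ceil_lt_add_one (by linarith)
    set k := ⌈q / 2⌉₊
    have hk0 : (0 : ℝ) < k := by positivity
    refine main ((n : ℝ) ^ (1 / q - 1 / (2 * k))) k hk1 ?_ ?_
    · intro x y
      refine (abs_inner_le_pnorm_mul_pnorm hconj.symm x y).trans ?_
      have := pnorm_le_card_mul_pnorm (q := q) (r := 2 * k) (by linarith) (by linarith) x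
      have := pnorm_nonneg p y
      gcongr
    · rw [hrho]
      calc ((n : ℝ) ^ (1 / q - 1 / (2 * k))) ^ 2 * (k * (n : ℝ) ^ (1 / (k : ℝ) - 1))
          = k * (n : ℝ) ^ (2 / q - 1) := by
            rw [← Real.rpow_natCast, ← Real.rpow_mul hn0.le, mul_left_comm, ← Real.rpow_add hn0]
            congr 2
            push_cast
            field_simp
            ring
        _ ≤ (12 * (q - 1)) * (n : ℝ) ^ (2 / q - 1) := by
            gcongr
            linarith
        _ = _ := by ring
  · have hk1 : 1 ≤ ⌈Real.log n⌉₊ := Nat.one_le_ceil_iff.2 (by linarith)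
    have hk2 : Real.log n ≤ ⌈Real.log n⌉₊ := Nat.le_ceil _
    have hk3 : (⌈Real.log n⌉₊ : ℝ) < Real.log n + 1 := Nat.ceil_lt_add_one (by linarith)
    set k := ⌈Real.log n⌉₊
    have hk0 : (1 : ℝ) ≤ k := by exact_mod_cast hk1
    have hconj : (2 * (k : ℝ)).HolderConjugate (2 * k / (2 * k - 1)) :=
      Real.HolderConjugate.conjExponent (by linarith)
    refine main 1 k hk1 ?_ ?_
    · intro x y
      refine (abs_inner_le_pnorm_mul_pnorm hconj x y).trans ?_
      rw [one_mul]
      -- Equivalent to `2k ≤ q`: indeed `2k < 2 ln n + 2 ≤ 16 ln n - 7 ≤ q` because `ln n > 0.69`.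
      have hle : p ≤ 2 * k / (2 * k - 1) := by
        rw [le_div_iff₀ (by linarith)]
        rcases hp with rfl | ⟨hp, hq⟩
        · linarith
        · have hp' : 1 < p := lt_of_le_of_ne hp₁ (Ne.symm hp)
          have : 2 * k ≤ p / (p - 1) := by linarith
          rw [le_div_iff₀ (by linarith)] at this
          linarith
      have := pnorm_anti hp₁ hle y
      have := pnorm_nonneg (2 * k) x
      gcongr
    · have hrho : (16 * Real.log n - 8) * (n : ℝ)⁻¹ ≤ rho p n := by
        rw [rho]
        split_ifs with h
        · exact le_rfl
        · rw [min_eq_right (by tauto)]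
          have hpos : 0 < 16 * Real.log n - 8 := by linarith
          rw [← Real.rpow_neg_one]
          have : (0 : ℝ) ≤ 2 / (p / (p - 1)) := by
            have : 0 ≤ p - 1 := by linarith
            positivity
          have hn1 : (1 : ℝ) ≤ n := by exact_mod_cast (by omega : 1 ≤ n)
          gcongr
          linarith
      have hexp : (n : ℝ) ^ (1 / (k : ℝ)) ≤ 2.72 := by
        rw [Real.rpow_def_of_pos hn0]
        calc Real.exp (Real.log n * (1 / k)) ≤ Real.exp 1 := by
              gcongr
              rw [mul_one_div, div_le_one (by linarith)]
              exact hk2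
          _ ≤ 2.72 := by linarith [Real.exp_one_lt_d9]
      calc (1 : ℝ) ^ 2 * (k * (n : ℝ) ^ (1 / (k : ℝ) - 1))
          = k * (n : ℝ) ^ (1 / (k : ℝ)) * (n : ℝ)⁻¹ := by
            rw [Real.rpow_sub hn0, Real.rpow_one]; ring
        _ ≤ (Real.log n + 1) * 2.72 * (n : ℝ)⁻¹ := by gcongr
        _ ≤ (12 * (16 * Real.log n - 8)) * (n : ℝ)⁻¹ := by
            refine mul_le_mul_of_nonneg_right ?_ (by positivity)
            linarith
        _ ≤ 12 * rho p n := by linarith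

/-! ### Convex functions and the proximal step -/

lemma add_inner_le_of_convexOn {n : ℕ} {φ : E n → ℝ} (hφ : ConvexOn ℝ Set.univ φ) {x v : E n}
    (hv : HasGradientAt φ v x) (y : E n) : φ x + ⟪v, y - x⟫ ≤ φ y := by
  have hc : ConvexOn ℝ Set.univ (φ ∘ AffineMap.lineMap (k := ℝ) x y) := by
    simpa using hφ.comp_affineMap (AffineMap.lineMap (k := ℝ) x y)
  have hd : HasDerivAt (φ ∘ AffineMap.lineMap (k := ℝ) x y) ⟪v, y - x⟫ 0 := by
    have h1 : HasDerivAt (AffineMap.lineMap (k := ℝ) x y) (y - x) (0 : ℝ) :=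
      AffineMap.hasDerivAt_lineMap
    have h2 := hv.hasFDerivAt
    rw [← AffineMap.lineMap_apply_zero (k := ℝ) x y] at h2
    simpa using h2.comp_hasDerivAt (0 : ℝ) h1
  have := hc.le_slope_of_hasDerivAt (Set.mem_univ 0) (Set.mem_univ 1) one_pos hd
  simp [slope] at this
  linarith

lemma bregman_nonneg {n : ℕ} {p : ℝ} {d : E n → ℝ} (hd : IsProxFunction p d) (z x : E n) :
    0 ≤ bregman d z x := by
  have := hd.strongly_convex z x
  have := sq_nonneg (pnorm p (x - z))
  unfold bregman
  linarith

lemma norm_sq_le_bregman {n : ℕ} {p : ℝ} (hp₁ : 1 ≤ p) (hp₂ : p ≤ 2) {d : E n → ℝ}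
    (hd : IsProxFunction p d) (z x : E n) : ‖x - z‖ ^ 2 ≤ 2 * bregman d z x := by
  have h1 := hd.strongly_convex z x
  have h2 := norm_le_pnorm hp₁ hp₂ (x - z)
  have h3 : ‖x - z‖ ^ 2 ≤ pnorm p (x - z) ^ 2 := by gcongr
  unfold bregman
  linarith

/-- The minimizer of `d z - ⟪v, z⟫`. -/
def proxPoint {n : ℕ} (d : E n → ℝ) (v : E n) : E n := argmin fun z => d z - ⟪v, z⟫

/-- Since `‖·‖₂ ≤ ‖·‖_p` for `p ≤ 2`, strong convexity makes the function coercive. A minimizer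
exists, and `Classical.epsilon` returns one. -/
lemma proxPoint_spec {n : ℕ} {p : ℝ} (hp₁ : 1 ≤ p) (hp₂ : p ≤ 2) {d : E n → ℝ}
    (hd : IsProxFunction p d) (v w : E n) :
    d (proxPoint d v) - ⟪v, proxPoint d v⟫ ≤ d w - ⟪v, w⟫ := by
  have hex : ∃ z, ∀ w, d z - ⟪v, z⟫ ≤ d w - ⟪v, w⟫ := by
    have hcont : Continuous fun z => d z - ⟪v, z⟫ := by
      have := hd.differentiable.continuous
      fun_prop
    refine hcont.exists_forall_le ?_
    have hlow : ∀ z, d 0 + ‖z‖ * (1 / 2 * ‖z‖ - ‖gradient d 0 - v‖) ≤ d z - ⟪v, z⟫ := by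
      intro z
      have h1 := norm_sq_le_bregman hp₁ hp₂ hd 0 z
      simp only [bregman, sub_zero] at h1
      have h2 := abs_le.1 (abs_real_inner_le_norm (gradient d 0 - v) z)
      rw [inner_sub_left] at h2
      nlinarith [h2.1]
    refine Filter.tendsto_atTop_mono hlow (Filter.tendsto_atTop_add_const_left _ _ ?_)
    have hn : Filter.Tendsto (fun z : E n => ‖z‖) (Filter.cocompact (E n)) Filter.atTop :=
      tendsto_norm_cocompact_atTop
    refine hn.atTop_mul_atTop₀ ?_
    exact Filter.tendsto_atTop_add_const_right _ _ (hn.const_mul_atTop (by norm_num))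
  exact Classical.epsilon_spec hex w

lemma gradient_proxPoint {n : ℕ} {p : ℝ} (hp₁ : 1 ≤ p) (hp₂ : p ≤ 2) {d : E n → ℝ}
    (hd : IsProxFunction p d) (v : E n) : gradient d (proxPoint d v) = v := by
  set z := proxPoint d v
  have hmin : IsLocalMin (fun w => d w - ⟪v, w⟫) z :=
    Filter.Eventually.of_forall fun w => proxPoint_spec hp₁ hp₂ hd v w
  have h1 : HasFDerivAt (fun w => d w - ⟪v, w⟫) (fderiv ℝ d z - innerSL ℝ v) z :=
    (hd.differentiable z).hasFDerivAt.sub (innerSL ℝ v).hasFDerivAt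
  have h2 := hmin.hasFDerivAt_eq_zero h1
  refine ext_inner_right ℝ fun w => ?_
  rw [inner_gradient_left]
  have h3 := DFunLike.congr_fun h2 w
  simp at h3
  linarith

/-- The two objectives differ by a constant, so the predicates given to `Classical.epsilon`
coincide. Uniqueness of the minimizer is not needed. -/
lemma argmin_prox_eq {n : ℕ} (d : E n → ℝ) (c : ℝ) (G z₀ : E n) :
    argmin (fun z => c * ⟪G, z - z₀⟫ + bregman d z₀ z) = proxPoint d (gradient d z₀ - c • G) := by
  unfold proxPoint argmin
  congr 1
  ext z
  refine forall_congr' fun w => ?_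
  simp only [bregman, inner_sub_left, inner_sub_right, real_inner_smul_left]
  constructor <;> intro h <;> linarith

/-- Adding the strong convexity inequalities at the two points gives `‖a - b‖² ≤ ⟪v - w, a - b⟫`.
The resulting continuity makes the iterates measurable. -/
lemma lipschitzWith_proxPoint {n : ℕ} {p : ℝ} (hp₁ : 1 ≤ p) (hp₂ : p ≤ 2) {d : E n → ℝ}
    (hd : IsProxFunction p d) : LipschitzWith 1 (proxPoint d) := by
  refine LipschitzWith.of_dist_le_mul fun v w => ?_
  rw [dist_eq_norm, dist_eq_norm, NNReal.coe_one, one_mul]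
  set a := proxPoint d v with ha
  set b := proxPoint d w with hb
  have h1 := norm_sq_le_bregman hp₁ hp₂ hd a b
  have h2 := norm_sq_le_bregman hp₁ hp₂ hd b a
  simp only [bregman, ha, hb, gradient_proxPoint hp₁ hp₂ hd] at h1 h2
  rw [← ha, ← hb] at h1 h2
  rw [norm_sub_rev] at h1
  have h3 := real_inner_le_norm (v - w) (a - b)
  simp only [inner_sub_left, inner_sub_right] at h1 h2 h3
  have h4 : ‖a - b‖ * ‖a - b‖ ≤ ‖v - w‖ * ‖a - b‖ := by nlinarith
  rcases (norm_nonneg (a - b)).eq_or_lt with h | h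
  · rw [← h]; exact norm_nonneg _
  · exact le_of_mul_le_mul_right h4 h

lemma measurable_gradient {n : ℕ} (d : E n → ℝ) : Measurable (gradient d) := by
  unfold gradient
  exact (InnerProductSpace.toDual ℝ (E n)).symm.continuous.measurable.comp (measurable_fderiv ℝ d)

/-- One mirror descent step along the direction `e`. -/
lemma bregman_mirror_step {n : ℕ} {p : ℝ} (hp₁ : 1 ≤ p) (hp₂ : p ≤ 2) {d : E n → ℝ}
    (hd : IsProxFunction p d) {R : E n → ℝ} (hR0 : ∀ x, 0 ≤ R x)
    (hR : ∀ x y, ⟪x, y⟫ ^ 2 ≤ R x * pnorm p y ^ 2) (c t : ℝ) (e z u : E n) :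
    bregman d (proxPoint d (gradient d z - c • t • e)) u ≤
      bregman d z u + c * (t * ⟪e, u - z⟫) + c ^ 2 * (t ^ 2 * R e) / 2 := by
  set v := gradient d z - c • t • e
  set z' := proxPoint d v
  have hg : gradient d z' = v := gradient_proxPoint hp₁ hp₂ hd v
  have h1 := hd.strongly_convex z z'
  have h2 := hR e (z' - z)
  -- Young's inequality. The `pnorm` term is absorbed by the strong convexity of `d`.
  have h3 : c * t * ⟪e, z - z'⟫ ≤ ((c * t) ^ 2 * R e + pnorm p (z' - z) ^ 2) / 2 := by
    refine le_of_abs_le (abs_le_of_sq_le_sq ?_ ?_)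
    · have : ⟪e, z - z'⟫ ^ 2 = ⟪e, z' - z⟫ ^ 2 := by
        rw [← neg_sub z' z, inner_neg_right, neg_sq]
      rw [mul_pow, this]
      have := mul_le_mul_of_nonneg_left h2 (sq_nonneg (c * t))
      nlinarith [sq_nonneg ((c * t) ^ 2 * R e - pnorm p (z' - z) ^ 2)]
    · have := hR0 e
      positivity
  -- The three-point identity for Bregman divergences, using the optimality condition `gradient d z'
  -- = v`.
  have h4 : bregman d z' u = bregman d z u + c * t * ⟪e, u - z⟫ + c * t * ⟪e, z - z'⟫ -
      (d z' - d z - ⟪gradient d z, z' - z⟫) := by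
    simp only [bregman, hg, v, inner_sub_left, inner_sub_right, real_inner_smul_left]
    ring
  rw [h4]
  nlinarith

/-- `f` is convex and smooth in the sense of two-sided quadratic bounds on its linearization
error. -/
def IsSmoothConvex {n : ℕ} (f : E n → ℝ) (L₂ : ℝ) : Prop :=
  ∀ x y, 0 ≤ f y - f x - ⟪gradient f x, y - x⟫ ∧
    f y - f x - ⟪gradient f x, y - x⟫ ≤ L₂ * ‖y - x‖ ^ 2

/-- The step length `1 / (2 L₂)` is optimal for the quadratic bound with constant `L₂`. Completing
the square isolates the estimation error `t - ⟪∇f, e⟫`. -/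
lemma descent_step {n : ℕ} {f : E n → ℝ} {L₂ : ℝ} (hL : 0 < L₂) (hf : IsSmoothConvex f L₂)
    (x e : E n) (he : ‖e‖ = 1) (t : ℝ) :
    f (x - (1 / (2 * L₂)) • t • e) ≤
      f x + ((t - ⟪gradient f x, e⟫) ^ 2 - ⟪gradient f x, e⟫ ^ 2) / (4 * L₂) := by
  have h := (hf x (x - (1 / (2 * L₂)) • t • e)).2
  rw [sub_sub_cancel_left, norm_neg, inner_neg_right, inner_smul_right, inner_smul_right,
    norm_smul, norm_smul, he, mul_one, mul_pow] at h
  simp only [Real.norm_eq_abs, sq_abs] at h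
  set a := ⟪gradient f x, e⟫
  have e1 : L₂ * ((1 / (2 * L₂)) ^ 2 * t ^ 2) = t ^ 2 / (4 * L₂) := by field_simp; ring
  have e2 : ((t - a) ^ 2 - a ^ 2) / (4 * L₂) = t ^ 2 / (4 * L₂) - (1 / (2 * L₂) * (t * a)) := by
    field_simp; ring
  rw [e2]
  rw [e1] at h
  linarith

/-- Convexity at `x` is used against `u` with weight `α` and against `y` with weight `w - α`. The
relation `w τ = α` makes the linear terms add up to `α (u - z)`. -/
lemma coupling_step {n : ℕ} {f : E n → ℝ} {L₂ : ℝ} (hf : IsSmoothConvex f L₂) (w α τ : ℝ)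
    (hα : 0 ≤ α) (hw : α ≤ w) (hτ : w * τ = α) (y z u : E n) :
    w * f (τ • z + (1 - τ) • y) + α * ⟪gradient f (τ • z + (1 - τ) • y), u - z⟫ ≤
      (w - α) * f y + α * f u := by
  set x := τ • z + (1 - τ) • y
  have h1 := mul_le_mul_of_nonneg_left (hf x u).1 hα
  have h2 := mul_le_mul_of_nonneg_left (hf x y).1 (sub_nonneg.2 hw)
  have h3 : α • (u - z) = α • (u - x) + (w - α) • (y - x) := by
    simp only [x]
    have : w - α = w * (1 - τ) := by rw [← hτ]; ring
    rw [this, ← hτ]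
    module
  have h4 : α * ⟪gradient f x, u - z⟫ =
      α * ⟪gradient f x, u - x⟫ + (w - α) * ⟪gradient f x, y - x⟫ := by
    simp only [← inner_smul_right, ← inner_add_right, h3]
  rw [h4]
  linarith

/-! ### The objective -/

section Objective

variable {n : ℕ} {X : Type*} [MeasurableSpace X] {P : Measure X} [IsProbabilityMeasure P]
  {F : E n → X → ℝ} {g : E n → X → E n} {L : X → ℝ} {L₂ : ℝ}

lemma integral_le_of_sqrt_le (hL : MemLp L 2 P) (hL₂ : Real.sqrt (∫ s, L s ^ 2 ∂P) ≤ L₂) :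
    ∫ s, L s ∂P ≤ L₂ := by
  refine le_trans (Real.le_sqrt_of_sq_le ?_) hL₂
  have h := variance_nonneg L P
  rw [variance_eq_sub hL] at h
  simpa using h

/-- The upper bound comes from the tangent inequality at `y` and the Lipschitz bound. No integration
along the segment is needed, at the price of the constant `l` instead of `l / 2`. -/
lemma linearization_bounds {φ : E n → ℝ} (hφ : ConvexOn ℝ Set.univ φ) {γ : E n → E n}
    (hγ : ∀ x, HasGradientAt φ (γ x) x) {l : ℝ} (hl : ∀ x y, ‖γ x - γ y‖ ≤ l * ‖x - y‖)
    (x y : E n) :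
    0 ≤ φ y - φ x - ⟪γ x, y - x⟫ ∧ φ y - φ x - ⟪γ x, y - x⟫ ≤ l * ‖y - x‖ ^ 2 := by
  have h1 := add_inner_le_of_convexOn hφ (hγ x) y
  have h2 := add_inner_le_of_convexOn hφ (hγ y) x
  refine ⟨by linarith, ?_⟩
  have h3 : ⟪γ y - γ x, y - x⟫ ≤ l * ‖y - x‖ * ‖y - x‖ :=
    (real_inner_le_norm _ _).trans (by gcongr; exact hl y x)
  rw [← neg_sub y x, inner_neg_right] at h2
  rw [inner_sub_left] at h3
  nlinarith

/-- Identifies `∇f` with `E g` without differentiating under the integral: the pointwise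
linearization bounds are integrated first. -/
lemma hasGradientAt_of_quadratic_bounds {φ : E n → ℝ} {v x : E n} {C : ℝ}
    (h : ∀ y, 0 ≤ φ y - φ x - ⟪v, y - x⟫ ∧ φ y - φ x - ⟪v, y - x⟫ ≤ C * ‖y - x‖ ^ 2) :
    HasGradientAt φ v x := by
  rw [hasGradientAt_iff_isLittleO]
  refine Asymptotics.IsBigO.trans_isLittleO (g := fun y => ‖y - x‖ ^ 2) ?_
    (Asymptotics.isLittleO_pow_sub_sub x one_lt_two)
  refine Asymptotics.IsBigO.of_bound C (Filter.Eventually.of_forall fun y => ?_)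
  rw [Real.norm_of_nonneg (h y).1, Real.norm_of_nonneg (by positivity)]
  exact (h y).2

lemma objective_bounds (hF_int : ∀ x, Integrable (F x) P)
    (hF_conv : ∀ᵐ s ∂P, ConvexOn ℝ Set.univ fun x => F x s)
    (hg_grad : ∀ᵐ s ∂P, ∀ x, HasGradientAt (fun x => F x s) (g x s) x)
    (hg_lip : ∀ᵐ s ∂P, ∀ x y, ‖g x s - g y s‖ ≤ L s * ‖x - y‖)
    (hL : MemLp L 2 P) (hL₂ : Real.sqrt (∫ s, L s ^ 2 ∂P) ≤ L₂)
    (hg_int : ∀ x, Integrable (g x) P) (x y : E n) :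
    0 ≤ objective P F y - objective P F x - ⟪∫ s, g x s ∂P, y - x⟫ ∧
      objective P F y - objective P F x - ⟪∫ s, g x s ∂P, y - x⟫ ≤ L₂ * ‖y - x‖ ^ 2 := by
  have hi1 : Integrable (fun s => ⟪g x s, y - x⟫) P := (hg_int x).inner_const (y - x)
  have hi2 : Integrable (fun s => F y s - F x s) P := (hF_int y).sub (hF_int x)
  have heq : objective P F y - objective P F x - ⟪∫ s, g x s ∂P, y - x⟫ =
      ∫ s, (F y s - F x s - ⟪g x s, y - x⟫) ∂P := by
    rw [integral_sub hi2 hi1, integral_sub (hF_int y) (hF_int x)]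
    congr 1
    simp only [real_inner_comm (y - x)]
    exact (integral_inner (hg_int x) (y - x)).symm
  have hb : ∀ᵐ s ∂P, 0 ≤ F y s - F x s - ⟪g x s, y - x⟫ ∧
      F y s - F x s - ⟪g x s, y - x⟫ ≤ L s * ‖y - x‖ ^ 2 := by
    filter_upwards [hF_conv, hg_grad, hg_lip] with s h1 h2 h3
    exact linearization_bounds h1 h2 h3 x y
  rw [heq]
  constructor
  · exact integral_nonneg_of_ae (hb.mono fun s h => h.1)
  · calc ∫ s, (F y s - F x s - ⟪g x s, y - x⟫) ∂P ≤ ∫ s, L s * ‖y - x‖ ^ 2 ∂P :=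
          integral_mono_ae (hi2.sub hi1) ((hL.integrable one_le_two).mul_const _)
            (hb.mono fun s h => h.2)
      _ = (∫ s, L s ∂P) * ‖y - x‖ ^ 2 := integral_mul_const _ _
      _ ≤ _ := by
        gcongr
        exact integral_le_of_sqrt_le hL hL₂

lemma gradient_objective (hF_int : ∀ x, Integrable (F x) P)
    (hF_conv : ∀ᵐ s ∂P, ConvexOn ℝ Set.univ fun x => F x s)
    (hg_grad : ∀ᵐ s ∂P, ∀ x, HasGradientAt (fun x => F x s) (g x s) x)
    (hg_lip : ∀ᵐ s ∂P, ∀ x y, ‖g x s - g y s‖ ≤ L s * ‖x - y‖)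
    (hL : MemLp L 2 P) (hL₂ : Real.sqrt (∫ s, L s ^ 2 ∂P) ≤ L₂)
    (hg_int : ∀ x, Integrable (g x) P) (x : E n) :
    HasGradientAt (objective P F) (∫ s, g x s ∂P) x :=
  hasGradientAt_of_quadratic_bounds
    (objective_bounds hF_int hF_conv hg_grad hg_lip hL hL₂ hg_int x)

lemma isSmoothConvex_objective (hF_int : ∀ x, Integrable (F x) P)
    (hF_conv : ∀ᵐ s ∂P, ConvexOn ℝ Set.univ fun x => F x s)
    (hg_grad : ∀ᵐ s ∂P, ∀ x, HasGradientAt (fun x => F x s) (g x s) x)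
    (hg_lip : ∀ᵐ s ∂P, ∀ x y, ‖g x s - g y s‖ ≤ L s * ‖x - y‖)
    (hL : MemLp L 2 P) (hL₂ : Real.sqrt (∫ s, L s ^ 2 ∂P) ≤ L₂)
    (hg_int : ∀ x, Integrable (g x) P) : IsSmoothConvex (objective P F) L₂ := by
  intro x y
  rw [(gradient_objective hF_int hF_conv hg_grad hg_lip hL hL₂ hg_int x).gradient]
  exact objective_bounds hF_int hF_conv hg_grad hg_lip hL hL₂ hg_int x y

end Objective

lemma memLp_sub_of_integrable_sq {n : ℕ} {X : Type*} [MeasurableSpace X] {P : Measure X}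
    {v : X → E n} (hv : Measurable v) (c : E n)
    (h : Integrable (fun s => ‖v s - c‖ ^ 2) P) : MemLp (fun s => v s - c) 2 P :=
  (memLp_two_iff_integrable_sq_norm (hv.sub_const c).aestronglyMeasurable).2 h

/-! ### Mini-batch averages -/

section Batch

variable {m : ℕ} {X : Type*} [MeasurableSpace X] {P : Measure X} [IsProbabilityMeasure P]

/-- The average of `h` over a batch. -/
def batchMean (h : X → ℝ) (s : Fin m → X) : ℝ := (1 / (m : ℝ)) * ∑ i, h (s i)

lemma integrable_eval {h : X → ℝ} (hh : Integrable h P) (i : Fin m) :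
    Integrable (fun s : Fin m → X => h (s i)) (Measure.pi fun _ => P) :=
  (measurePreserving_eval (fun _ : Fin m => P) i).integrable_comp_of_integrable hh

lemma integrable_batchMean {h : X → ℝ} (hh : Integrable h P) :
    Integrable (batchMean h) (Measure.pi fun _ : Fin m => P) :=
  (integrable_finsetSum _ fun i _ => integrable_eval hh i).const_mul _

lemma memLp_batchMean {h : X → ℝ} (hh : MemLp h 2 P) :
    MemLp (batchMean h) 2 (Measure.pi fun _ : Fin m => P) := by
  have h1 : MemLp (fun s : Fin m → X => ∑ i, h (s i)) 2 (Measure.pi fun _ : Fin m => P) :=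
    memLp_finsetSum _ fun i _ => hh.comp_measurePreserving (measurePreserving_eval _ i)
  exact h1.const_mul _

lemma integral_batchMean (hm : 1 ≤ m) {h : X → ℝ} (hh : Integrable h P) :
    ∫ s, batchMean h s ∂(Measure.pi fun _ : Fin m => P) = ∫ s, h s ∂P := by
  have hm0 : (m : ℝ) ≠ 0 := by positivity
  unfold batchMean
  rw [integral_const_mul, integral_finsetSum _ fun i _ => integrable_eval hh i]
  have : ∀ i : Fin m, ∫ s, h (s i) ∂(Measure.pi fun _ : Fin m => P) = ∫ s, h s ∂P := by
    intro i
    have hp := measurePreserving_eval (fun _ : Fin m => P) i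
    conv_rhs => rw [← hp.map_eq]
    rw [integral_map hp.measurable.aemeasurable (by rw [hp.map_eq]; exact hh.aestronglyMeasurable)]
  simp only [this]
  simp
  field_simp

lemma integral_batchMean_sq_of_centered (hm : 1 ≤ m) {h : X → ℝ} (hh : MemLp h 2 P)
    (h0 : ∫ s, h s ∂P = 0) :
    ∫ s, batchMean h s ^ 2 ∂(Measure.pi fun _ : Fin m => P) = (1 / (m : ℝ)) * ∫ s, h s ^ 2 ∂P := by
  have hm0 : (m : ℝ) ≠ 0 := by positivity
  have h1 := variance_sum_pi (μ := fun _ : Fin m => P) (X := fun _ => h) fun _ => hh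
  have hmean := integral_batchMean hm (hh.integrable one_le_two)
  rw [h0] at hmean
  have h2 := variance_of_integral_eq_zero (memLp_batchMean (m := m) hh).aestronglyMeasurable.aemeasurable
    hmean
  rw [← h2]
  have h3 : batchMean (m := m) h = fun s => (1 / (m : ℝ)) * (∑ i, fun s : Fin m → X => h (s i)) s := by
    ext s
    simp [batchMean]
  rw [h3, variance_const_mul, h1]
  have h4 := variance_of_integral_eq_zero hh.aestronglyMeasurable.aemeasurable h0
  simp only [h4]
  simp
  field_simp

/-- Meant for the noise, which need not be centered. Only Cauchy–Schwarz applies, so there is no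
gain `1/m`. -/
lemma integral_batchMean_sq_le (hm : 1 ≤ m) {h : X → ℝ} (hh : MemLp h 2 P) :
    ∫ s, batchMean h s ^ 2 ∂(Measure.pi fun _ : Fin m => P) ≤ ∫ s, h s ^ 2 ∂P := by
  have hm0 : (0 : ℝ) < m := by positivity
  rw [← integral_batchMean hm hh.integrable_sq]
  refine integral_mono (memLp_batchMean hh).integrable_sq ?_ fun s => ?_
  · exact integrable_batchMean hh.integrable_sq
  · have := sq_sum_le_card_mul_sum_sq (s := Finset.univ) (f := fun i => h (s i))
    simp only [Finset.card_univ, Fintype.card_fin] at this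
    simp only [batchMean, mul_pow]
    calc (1 / (m : ℝ)) ^ 2 * (∑ i, h (s i)) ^ 2
        ≤ (1 / (m : ℝ)) ^ 2 * (m * ∑ i, h (s i) ^ 2) := by gcongr
      _ = _ := by field_simp

lemma integral_le_sqrt_integral_sq {h : X → ℝ} (hh : MemLp h 2 P) :
    ∫ s, h s ∂P ≤ Real.sqrt (∫ s, h s ^ 2 ∂P) :=
  integral_le_of_sqrt_le hh le_rfl

end Batch

/-! ### One iteration from a fixed state -/

/-- The conclusion includes `0 ≤ K` so that the lemma can be iterated, over the batch and then over
the direction. -/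
lemma lintegral_ofReal_le_of_le {α : Type*} [MeasurableSpace α] {μ : Measure α} {φ U : α → ℝ}
    {K : ℝ} (h0 : ∀ a, 0 ≤ φ a) (hU : ∀ a, φ a ≤ U a) (hint : Integrable U μ)
    (hK : ∫ a, U a ∂μ ≤ K) : ∫⁻ a, ENNReal.ofReal (φ a) ∂μ ≤ ENNReal.ofReal K ∧ 0 ≤ K := by
  have hU0 : ∀ a, 0 ≤ U a := fun a => (h0 a).trans (hU a)
  refine ⟨?_, (integral_nonneg hU0).trans hK⟩
  calc ∫⁻ a, ENNReal.ofReal (φ a) ∂μ ≤ ∫⁻ a, ENNReal.ofReal (U a) ∂μ :=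
        lintegral_mono fun a => ENNReal.ofReal_le_ofReal (hU a)
    _ = ENNReal.ofReal (∫ a, U a ∂μ) :=
        (ofReal_integral_eq_lintegral_ofReal hint (Filter.Eventually.of_forall hU0)).symm
    _ ≤ ENNReal.ofReal K := ENNReal.ofReal_le_ofReal hK

lemma integral_abs_inner_le {n : ℕ} (hn : 2 ≤ n) (v : E n) :
    ∫ e : S n, |⟪(e : E n), v⟫| ∂(unifSphere n) ≤ ‖v‖ / Real.sqrt n := by
  have := isProbabilityMeasure_unifSphere hn
  have hn0 : (0 : ℝ) < n := by positivity
  have hc : Continuous fun e : S n => |⟪(e : E n), v⟫| := by fun_prop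
  have h2 : ∫ e : S n, |⟪(e : E n), v⟫| ^ 2 ∂(unifSphere n) = ‖v‖ ^ 2 / n := by
    rw [← real_inner_self_eq_norm_sq, ← integral_inner_mul_inner_one hn]
    simp only [sq_abs]
    simp only [real_inner_comm v, sq]
  have hm : MemLp (fun e : S n => |⟪(e : E n), v⟫|) 2 (unifSphere n) :=
    (memLp_two_iff_integrable_sq hc.aestronglyMeasurable).2
      (continuous_integrable_unifSphere hn (hc.pow 2))
  refine (integral_le_sqrt_integral_sq hm).trans ?_
  rw [h2, Real.sqrt_div (by positivity), Real.sqrt_sq (norm_nonneg _)]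

lemma integral_second_moment {n : ℕ} (hn : 2 ≤ n) {X : Type*} [MeasurableSpace X] {P : Measure X}
    [IsProbabilityMeasure P] {v : X → E n} (hv : Measurable v)
    (hint : Integrable (fun s => ‖v s‖ ^ 2) P) {R : E n → ℝ} (hR : Continuous R)
    (hs : IsSymmetric R) :
    Integrable (fun e : S n => (∫ s, ⟪v s, (e : E n)⟫ ^ 2 ∂P) * R e) (unifSphere n) ∧
    ∫ e : S n, (∫ s, ⟪v s, (e : E n)⟫ ^ 2 ∂P) * R e ∂(unifSphere n) =
      (∫ s, ‖v s‖ ^ 2 ∂P) / n * ∫ e : S n, R e ∂(unifSphere n) := by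
  have := isProbabilityMeasure_unifSphere hn
  have hRi : Integrable (fun e : S n => |R e|) (unifSphere n) :=
    continuous_integrable_unifSphere hn (by fun_prop)
  have hprod : Integrable (fun q : S n × X => ⟪v q.2, (q.1 : E n)⟫ ^ 2 * R q.1)
      ((unifSphere n).prod P) := by
    refine (hRi.mul_prod hint).mono ?_ (Filter.Eventually.of_forall fun q => ?_)
    · refine Measurable.aestronglyMeasurable ?_
      have := hR.measurable
      fun_prop
    · have h1 : ⟪v q.2, (q.1 : E n)⟫ ^ 2 ≤ ‖v q.2‖ ^ 2 := by
        have := abs_real_inner_le_norm (v q.2) (q.1 : E n)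
        rw [show ‖(q.1 : E n)‖ = 1 by simp, mul_one] at this
        rw [← sq_abs]
        gcongr
      rw [norm_mul, norm_mul, Real.norm_of_nonneg (by positivity), Real.norm_eq_abs,
        Real.norm_eq_abs, abs_abs, Real.norm_of_nonneg (by positivity), mul_comm]
      gcongr
  have heq : ∀ e : S n, (∫ s, ⟪v s, (e : E n)⟫ ^ 2 ∂P) * R e =
      ∫ s, ⟪v s, (e : E n)⟫ ^ 2 * R e ∂P := fun e => (integral_mul_const _ _).symm
  simp only [heq]
  refine ⟨hprod.integral_prod_left, ?_⟩
  rw [integral_integral_swap hprod]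
  have h2 : ∀ s, ∫ e : S n, ⟪v s, (e : E n)⟫ ^ 2 * R e ∂(unifSphere n) =
      ‖v s‖ ^ 2 * ((∫ e : S n, R e ∂(unifSphere n)) / n) := by
    intro s
    simp only [sq ⟪_, _⟫]
    rw [integral_inner_mul_inner hn hR hs, real_inner_self_eq_norm_sq]
    ring
  simp only [h2]
  rw [integral_mul_const]
  ring

lemma batchMean_add {m : ℕ} {X : Type*} (h₁ h₂ : X → ℝ) (s : Fin m → X) :
    batchMean (fun x => h₁ x + h₂ x) s = batchMean h₁ s + batchMean h₂ s := by
  simp [batchMean, Finset.sum_add_distrib, mul_add]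

lemma batchMean_const {m : ℕ} (hm : 1 ≤ m) {X : Type*} (c : ℝ) (s : Fin m → X) :
    batchMean (fun _ => c) s = c := by
  have hm0 : (m : ℝ) ≠ 0 := by positivity
  simp [batchMean]
  field_simp

lemma gradEst_eq {n m : ℕ} {X : Type*} (D : E n → X → S n → ℝ) (x : E n) (s : Fin m → X)
    (e : S n) : gradEst D x s e = batchMean (fun r => D x r e) s • (e : E n) := by
  rw [gradEst, batchMean, ← Finset.sum_smul, smul_smul]

lemma noise_moments {X : Type*} [MeasurableSpace X] {P : Measure X} [IsProbabilityMeasure P]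
    {m : ℕ} (hm : 1 ≤ m) {Z H : X → ℝ} (hZ : Measurable Z) (hH : Measurable H) {Δζ Δη : ℝ}
    (hZi : Integrable (fun s => Z s ^ 2) P) (hZb : ∫ s, Z s ^ 2 ∂P ≤ Δζ)
    (hHb : ∀ᵐ s ∂P, |H s| ≤ Δη) :
    MemLp (fun s => Z s + H s) 2 P ∧
    ∫ s, batchMean (fun s => Z s + H s) s ^ 2 ∂(Measure.pi fun _ : Fin m => P) ≤
      2 * Δζ + 2 * Δη ^ 2 ∧
    |∫ s, batchMean (fun s => Z s + H s) s ∂(Measure.pi fun _ : Fin m => P)| ≤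
      Real.sqrt Δζ + Δη := by
  have hZ2 : MemLp Z 2 P := (memLp_two_iff_integrable_sq hZ.aestronglyMeasurable).2 hZi
  have hH2 : MemLp H 2 P := MemLp.of_bound hH.aestronglyMeasurable Δη hHb
  have hω : MemLp (fun s => Z s + H s) 2 P := hZ2.add hH2
  have hHsq : ∫ s, H s ^ 2 ∂P ≤ Δη ^ 2 := by
    calc ∫ s, H s ^ 2 ∂P ≤ ∫ _s, Δη ^ 2 ∂P :=
          integral_mono_ae hH2.integrable_sq (integrable_const _) (hHb.mono fun s hs => by
            dsimp only
            rw [← sq_abs]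
            gcongr)
      _ = _ := by simp
  refine ⟨hω, ?_, ?_⟩
  · calc _ ≤ ∫ s, (Z s + H s) ^ 2 ∂P := integral_batchMean_sq_le hm hω
      _ ≤ ∫ s, (2 * Z s ^ 2 + 2 * H s ^ 2) ∂P :=
        integral_mono hω.integrable_sq ((hZi.const_mul 2).add (hH2.integrable_sq.const_mul 2))
          fun s => by nlinarith [sq_nonneg (Z s - H s)]
      _ ≤ _ := by
        rw [integral_add (hZi.const_mul 2) (hH2.integrable_sq.const_mul 2), integral_const_mul,
          integral_const_mul]
        linarith
  · rw [integral_batchMean hm (hω.integrable one_le_two),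
      integral_add (hZ2.integrable one_le_two) (hH2.integrable one_le_two)]
    refine (abs_add_le _ _).trans (add_le_add ?_ ?_)
    · refine (abs_integral_le_integral_abs).trans ?_
      refine (integral_le_sqrt_integral_sq hZ2.abs).trans ?_
      refine Real.sqrt_le_sqrt ?_
      simpa using hZb
    · calc |∫ s, H s ∂P| ≤ ∫ s, |H s| ∂P := abs_integral_le_integral_abs
        _ ≤ ∫ _s, Δη ∂P :=
          integral_mono_ae (hH2.integrable one_le_two).abs (integrable_const _) hHb
        _ = _ := by simp

lemma integral_add_const_mul {α : Type*} [MeasurableSpace α] {μ : Measure α} {A h : α → ℝ} {I : ℝ}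
    (hA : Integrable A μ ∧ ∫ a, A a ∂μ = I) (c : ℝ) (hh : Integrable h μ) :
    Integrable (fun a => A a + c * h a) μ ∧ ∫ a, (A a + c * h a) ∂μ = I + c * ∫ a, h a ∂μ :=
  ⟨hA.1.add (hh.const_mul c), by
    rw [integral_add hA.1 (hh.const_mul c), hA.2, integral_const_mul]⟩

lemma integral_const_probability {α : Type*} [MeasurableSpace α] {μ : Measure α}
    [IsProbabilityMeasure μ] (c : ℝ) :
    Integrable (fun _ : α => c) μ ∧ ∫ _a, c ∂μ = c :=
  ⟨integrable_const c, by simp⟩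

/-- Here `a` is the true derivative, `b` the centered sampling error and `ω` the noise. The bounds
are `(b + ω)² ≤ 5b² + (5/4)ω²` and `(a + b + ω)²/2 ≤ (a + b)² + ω²`. The cross term `2ab` stays
exact because it averages to zero, so the coefficient of `a²` in the mirror cost is just `c² r`. -/
lemma one_step_scalar {w L₂ c r a b ω q φ φ' φu V V' : ℝ} (hL : 0 < L₂) (hw : 0 ≤ w) (hr : 0 ≤ r)
    (h1 : φ' ≤ φ + ((a + b + ω - a) ^ 2 - a ^ 2) / (4 * L₂))
    (h2 : V' ≤ V + c * ((a + b + ω) * q) + c ^ 2 * ((a + b + ω) ^ 2 * r) / 2) :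
    w * (φ' - φu) + V' ≤
      (w * (φ - φu) + V - w / (4 * L₂) * a ^ 2 + c * (a * q) + c ^ 2 * r * a ^ 2) +
        (c * q + 2 * c ^ 2 * r * a) * b + (c * q) * ω + (w / (4 * L₂) * 5 + c ^ 2 * r) * b ^ 2 +
        (w / (4 * L₂) * (5 / 4) + c ^ 2 * r) * ω ^ 2 := by
  have hD : 0 ≤ w / (4 * L₂) := by positivity
  have hcr : 0 ≤ c ^ 2 * r := by positivity
  have h3 : w * φ' ≤ w * φ + w / (4 * L₂) * ((b + ω) ^ 2 - a ^ 2) :=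
    (mul_le_mul_of_nonneg_left h1 hw).trans_eq (by ring)
  have h4 := mul_nonneg hD (sq_nonneg (2 * b - ω / 2))
  have h5 := mul_nonneg hcr (sq_nonneg (a + b - ω))
  linarith

/-- The batch is averaged with `e` frozen, because the noise may depend on `e`. Its conditional bias
survives as the term in `|⟪e, u - z⟫|`. -/
lemma one_step_fixed_direction {n : ℕ} {p : ℝ} (hp₁ : 1 ≤ p) (hp₂ : p ≤ 2)
    {d : E n → ℝ} (hd : IsProxFunction p d) {R : E n → ℝ} (hR0 : ∀ x, 0 ≤ R x)
    (hR : ∀ x y, ⟪x, y⟫ ^ 2 ≤ R x * pnorm p y ^ 2)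
    {f : E n → ℝ} {L₂ : ℝ} (hL : 0 < L₂) (hf : IsSmoothConvex f L₂) {u : E n}
    (hu : ∀ x, f u ≤ f x)
    {X : Type*} [MeasurableSpace X] {P : Measure X} [IsProbabilityMeasure P]
    {m : ℕ} (hm : 1 ≤ m) (x z : E n) {γ : X → E n} (hγ : Measurable γ)
    (hγi : Integrable (fun s => ‖γ s - gradient f x‖ ^ 2) P) (hγm : ∫ s, γ s ∂P = gradient f x)
    {Z H : X → ℝ} (hZ : Measurable Z) (hH : Measurable H) {Δζ Δη : ℝ}
    (hZi : Integrable (fun s => Z s ^ 2) P) (hZb : ∫ s, Z s ^ 2 ∂P ≤ Δζ)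
    (hHb : ∀ᵐ s ∂P, |H s| ≤ Δη) (e : S n) {w c : ℝ} (hw : 0 ≤ w) (hc : 0 ≤ c) :
    ∫⁻ s : Fin m → X, ENNReal.ofReal
        (w * (f (x - (1 / (2 * L₂)) •
          batchMean (fun r => ⟪γ r, (e : E n)⟫ + Z r + H r) s • (e : E n)) - f u) +
        bregman d (proxPoint d (gradient d z - c •
          batchMean (fun r => ⟪γ r, (e : E n)⟫ + Z r + H r) s • (e : E n))) u)
        ∂(Measure.pi fun _ => P) ≤
      ENNReal.ofReal (w * (f x - f u) + bregman d z u +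
        w / (4 * L₂) * (5 * ((1 / (m : ℝ)) * ∫ s, ⟪γ s - gradient f x, (e : E n)⟫ ^ 2 ∂P) +
          5 / 4 * (2 * Δζ + 2 * Δη ^ 2) - ⟪gradient f x, (e : E n)⟫ ^ 2) +
        c * (⟪gradient f x, (e : E n)⟫ * ⟪(e : E n), u - z⟫) +
        c * (Real.sqrt Δζ + Δη) * |⟪(e : E n), u - z⟫| +
        c ^ 2 * R e * (⟪gradient f x, (e : E n)⟫ ^ 2 +
          (1 / (m : ℝ)) * ∫ s, ⟪γ s - gradient f x, (e : E n)⟫ ^ 2 ∂P +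
          (2 * Δζ + 2 * Δη ^ 2))) ∧
      0 ≤ w * (f x - f u) + bregman d z u +
        w / (4 * L₂) * (5 * ((1 / (m : ℝ)) * ∫ s, ⟪γ s - gradient f x, (e : E n)⟫ ^ 2 ∂P) +
          5 / 4 * (2 * Δζ + 2 * Δη ^ 2) - ⟪gradient f x, (e : E n)⟫ ^ 2) +
        c * (⟪gradient f x, (e : E n)⟫ * ⟪(e : E n), u - z⟫) +
        c * (Real.sqrt Δζ + Δη) * |⟪(e : E n), u - z⟫| +
        c ^ 2 * R e * (⟪gradient f x, (e : E n)⟫ ^ 2 +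
          (1 / (m : ℝ)) * ∫ s, ⟪γ s - gradient f x, (e : E n)⟫ ^ 2 ∂P +
          (2 * Δζ + 2 * Δη ^ 2)) := by
  obtain ⟨hω, hω2, hω1⟩ := noise_moments hm hZ hH hZi hZb hHb
  set G := gradient f x with hG
  set a := ⟪G, (e : E n)⟫ with ha
  set q := ⟪(e : E n), u - z⟫ with hq
  have hv : MemLp (fun s => γ s - G) 2 P := memLp_sub_of_integrable_sq hγ G hγi
  have hγint : Integrable γ P := by
    refine ((hv.integrable one_le_two).add (integrable_const G)).congr
      (Filter.Eventually.of_forall fun s => ?_)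
    simp
  have hb : MemLp (fun s => ⟪γ s - G, (e : E n)⟫) 2 P := hv.inner_const _
  have hb0 : ∫ s, ⟪γ s - G, (e : E n)⟫ ∂P = 0 := by
    simp only [real_inner_comm (e : E n)]
    rw [integral_inner (hv.integrable one_le_two), integral_sub hγint (integrable_const _), hγm]
    simp
  have hB2 := integral_batchMean_sq_of_centered hm hb hb0
  have hB1 := integral_batchMean hm (hb.integrable one_le_two)
  rw [hb0] at hB1
  have hBL := memLp_batchMean (m := m) hb
  have hWL := memLp_batchMean (m := m) hω
  set b : (Fin m → X) → ℝ := batchMean fun s => ⟪γ s - G, (e : E n)⟫ with hbdef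
  set ω : (Fin m → X) → ℝ := batchMean fun s => Z s + H s with hωdef
  have ht : ∀ s : Fin m → X, batchMean (fun r => ⟪γ r, (e : E n)⟫ + Z r + H r) s =
      a + b s + ω s := by
    intro s
    rw [← batchMean_const hm a s, hbdef, hωdef, ← batchMean_add, ← batchMean_add]
    congr 1
    ext r
    simp only [inner_sub_left, ha]
    ring
  simp only [ht]
  set V := bregman d z u
  set Bm := (1 / (m : ℝ)) * ∫ s, ⟪γ s - G, (e : E n)⟫ ^ 2 ∂P
  set W := 2 * Δζ + 2 * Δη ^ 2
  set κ := Real.sqrt Δζ + Δη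
  have hbi := hBL.integrable one_le_two
  have hωi := hWL.integrable one_le_two
  have hb2i := hBL.integrable_sq
  have hω2i := hWL.integrable_sq
  have hR0e := hR0 (e : E n)
  have hwL : 0 ≤ w / (4 * L₂) := by positivity
  have hI := integral_add_const_mul (integral_add_const_mul (integral_add_const_mul
    (integral_add_const_mul (integral_const_probability (μ := Measure.pi fun _ : Fin m => P)
      (w * (f x - f u) + V - w / (4 * L₂) * a ^ 2 + c * (a * q) + c ^ 2 * R e * a ^ 2))
      (c * q + 2 * c ^ 2 * R e * a) hbi) (c * q) hωi) (w / (4 * L₂) * 5 + c ^ 2 * R e) hb2i)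
    (w / (4 * L₂) * (5 / 4) + c ^ 2 * R e) hω2i
  refine lintegral_ofReal_le_of_le (U := fun s =>
    (w * (f x - f u) + V - w / (4 * L₂) * a ^ 2 + c * (a * q) + c ^ 2 * R e * a ^ 2) +
      (c * q + 2 * c ^ 2 * R e * a) * b s + (c * q) * ω s +
      (w / (4 * L₂) * 5 + c ^ 2 * R e) * b s ^ 2 +
      (w / (4 * L₂) * (5 / 4) + c ^ 2 * R e) * ω s ^ 2) ?_ ?_ ?_ ?_
  · intro s
    have h1 := hu (x - (1 / (2 * L₂)) • (a + b s + ω s) • (e : E n))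
    have h2 := bregman_nonneg hd (proxPoint d (gradient d z - c • (a + b s + ω s) • (e : E n))) u
    have := mul_nonneg hw (sub_nonneg.2 h1)
    linarith
  · intro s
    have h1 := descent_step hL hf x e (by simp) (a + b s + ω s)
    rw [← hG, ← ha] at h1
    have h2 := bregman_mirror_step hp₁ hp₂ hd hR0 hR c (a + b s + ω s) e z u
    rw [← hq] at h2
    generalize f (x - (1 / (2 * L₂)) • (a + b s + ω s) • (e : E n)) = φ at h1 ⊢
    generalize bregman d (proxPoint d (gradient d z - c • (a + b s + ω s) • (e : E n))) u = V' at h2 ⊢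
    exact one_step_scalar hL hw hR0e h1 h2
  · exact hI.1
  · refine hI.2.trans_le ?_
    rw [hB1, hB2]
    have h1 : c * q * ∫ s, ω s ∂(Measure.pi fun _ : Fin m => P) ≤ c * κ * |q| := by
      refine le_of_abs_le ?_
      rw [abs_mul, abs_mul, abs_of_nonneg hc]
      have := mul_le_mul_of_nonneg_left hω1 (mul_nonneg hc (abs_nonneg q))
      linarith
    have h2 : (w / (4 * L₂) * (5 / 4) + c ^ 2 * R e) *
        ∫ s, ω s ^ 2 ∂(Measure.pi fun _ : Fin m => P) ≤
        (w / (4 * L₂) * (5 / 4) + c ^ 2 * R e) * W :=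
      mul_le_mul_of_nonneg_left hω2 (by positivity)
    linarith

lemma one_step_fixed_state {n : ℕ} (hn : 2 ≤ n) {p : ℝ} (hp₁ : 1 ≤ p) (hp₂ : p ≤ 2)
    {d : E n → ℝ} (hd : IsProxFunction p d)
    {f : E n → ℝ} {L₂ : ℝ} (hL : 0 < L₂) (hf : IsSmoothConvex f L₂) {u : E n}
    (hu : ∀ x, f u ≤ f x)
    {X : Type*} [MeasurableSpace X] {P : Measure X} [IsProbabilityMeasure P]
    {m : ℕ} (hm : 1 ≤ m) (y z : E n) {α τ w σ : ℝ} (hα : 0 ≤ α) (hαw : α ≤ w) (hτ : w * τ = α)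
    (hw : w = 48 * n ^ 2 * rho p n * L₂ * α ^ 2)
    {x : E n} (hx : x = τ • z + (1 - τ) • y) {γ : X → E n} (hγ : Measurable γ)
    (hγi : Integrable (fun s => ‖γ s - gradient f x‖ ^ 2) P) (hγm : ∫ s, γ s ∂P = gradient f x)
    (hσ : ∫ s, ‖γ s - gradient f x‖ ^ 2 ∂P ≤ σ ^ 2)
    {Z H : X → S n → ℝ} (hZ : ∀ e, Measurable fun s => Z s e) (hH : ∀ e, Measurable fun s => H s e)
    {Δζ Δη : ℝ} (hΔη : 0 ≤ Δη)
    (hZi : ∀ e, Integrable (fun s => Z s e ^ 2) P) (hZb : ∀ e, ∫ s, Z s e ^ 2 ∂P ≤ Δζ)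
    (hHb : ∀ e, ∀ᵐ s ∂P, |H s e| ≤ Δη) :
    ∫⁻ e : S n, ∫⁻ s : Fin m → X, ENNReal.ofReal
        (w * (f (x - (1 / (2 * L₂)) •
          batchMean (fun r => ⟪γ r, (e : E n)⟫ + Z r e + H r e) s • (e : E n)) - f u) +
        bregman d (proxPoint d (gradient d z - (α * n) •
          batchMean (fun r => ⟪γ r, (e : E n)⟫ + Z r e + H r e) s • (e : E n))) u)
        ∂(Measure.pi fun _ => P) ∂(unifSphere n) ≤
      ENNReal.ofReal ((w - α) * (f y - f u) + bregman d z u +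
        w / (4 * L₂) * (6 * (σ ^ 2 / (m * n)) + 9 / 4 * (2 * Δζ + 2 * Δη ^ 2)) +
        α * Real.sqrt n * (Real.sqrt Δζ + Δη) * ‖u - z‖) := by
  have := isProbabilityMeasure_unifSphere hn
  obtain ⟨R, hRc, hRs, hR0, hR, hRint⟩ := exists_symmetric_dual_bound hn hp₁ hp₂
  have hn0 : (0 : ℝ) < n := by positivity
  have hm0 : (0 : ℝ) < m := by positivity
  have hw0 : 0 ≤ w := hα.trans hαw
  have hαn : 0 ≤ α * n := by positivity
  have key := fun e : S n => one_step_fixed_direction hp₁ hp₂ hd hR0 hR hL hf hu hm x z hγ hγi hγm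
    (hZ e) (hH e) (hZi e) (hZb e) (hHb e) e hw0 hαn
  set G := gradient f x with hG
  set W := 2 * Δζ + 2 * Δη ^ 2 with hWdef
  set κ := Real.sqrt Δζ + Δη with hκdef
  have hW0 : 0 ≤ W := by
    have h1 : 0 ≤ Δζ := by
      obtain ⟨e⟩ : Nonempty (S n) := (unifSphere n).nonempty_of_neZero
      exact (integral_nonneg fun s => sq_nonneg _).trans (hZb e)
    positivity
  have hκ0 : 0 ≤ κ := by positivity
  set V := bregman d z u
  set B : S n → ℝ := fun e => ∫ s, ⟪γ s - G, (e : E n)⟫ ^ 2 ∂P with hBdef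
  set a : S n → ℝ := fun e => ⟪G, (e : E n)⟫ with hadef
  set q : S n → ℝ := fun e => ⟪(e : E n), u - z⟫ with hqdef
  have hv : Measurable fun s => γ s - G := hγ.sub_const G
  obtain ⟨hBR, hBRe⟩ := integral_second_moment hn hv hγi hRc hRs
  obtain ⟨hB1, hB1e⟩ := integral_second_moment hn hv hγi (R := fun _ => 1) continuous_const
    ⟨by simp, by simp⟩
  simp only [mul_one, integral_const, probReal_univ, one_smul] at hB1 hB1e
  have ha2 : ∫ e, a e ^ 2 ∂(unifSphere n) = ‖G‖ ^ 2 / n := by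
    rw [← real_inner_self_eq_norm_sq, ← integral_inner_mul_inner_one hn]
    simp only [hadef, sq]
  have ha2R : ∫ e : S n, a e ^ 2 * R e ∂(unifSphere n) =
      ‖G‖ ^ 2 / n * ∫ e : S n, R e ∂(unifSphere n) := by
    rw [← real_inner_self_eq_norm_sq, ← integral_inner_mul_inner hn hRc hRs]
    simp only [hadef, sq]
  have haq : ∫ e, a e * q e ∂(unifSphere n) = ⟪G, u - z⟫ / n := by
    rw [← integral_inner_mul_inner_one hn]
    simp only [hadef, hqdef, real_inner_comm (u - z)]
  have hq1 := integral_abs_inner_le hn (u - z)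
  have hac : Continuous a := by fun_prop
  have hqc : Continuous q := by fun_prop
  have ia2 := continuous_integrable_unifSphere hn (hac.pow 2)
  have ia2R := continuous_integrable_unifSphere hn
    ((hac.pow 2).mul (hRc.comp continuous_subtype_val))
  have iaq := continuous_integrable_unifSphere hn (hac.mul hqc)
  have iq := continuous_integrable_unifSphere hn hqc.abs
  have iR := continuous_integrable_unifSphere hn (hRc.comp continuous_subtype_val)
  set ρ' := ∫ e : S n, R e ∂(unifSphere n) with hρ'
  have hρ'0 : 0 ≤ ρ' := integral_nonneg fun e => hR0 _
  set T := ∫ s, ‖γ s - G‖ ^ 2 ∂P with hT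
  have hT0 : 0 ≤ T := integral_nonneg fun s => by positivity
  refine (lintegral_mono fun e => (key e).1).trans ?_
  set D := w / (4 * L₂) with hD
  have hI := integral_add_const_mul (integral_add_const_mul (integral_add_const_mul
    (integral_add_const_mul (integral_add_const_mul (integral_add_const_mul (integral_add_const_mul
    (integral_const_probability (μ := unifSphere n)
      (w * (f x - f u) + V + D * (5 / 4 * W)))
      (D * 5 * (1 / (m : ℝ))) hB1) (-D) ia2) (α * n) iaq) (α * n * κ) iq) ((α * n) ^ 2) ia2R)
      ((α * n) ^ 2 * (1 / (m : ℝ))) hBR) ((α * n) ^ 2 * W) iR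
  simp only [Pi.mul_apply, Pi.pow_apply, Function.comp_apply] at hI
  refine (lintegral_ofReal_le_of_le (U := fun e =>
    (w * (f x - f u) + V + D * (5 / 4 * W)) +
      (D * 5 * (1 / (m : ℝ))) * B e + (-(D)) * a e ^ 2 +
      (α * n) * (a e * q e) + (α * n * κ) * |q e| +
      (α * n) ^ 2 * (a e ^ 2 * R e) + ((α * n) ^ 2 * (1 / (m : ℝ))) * (B e * R e) +
      ((α * n) ^ 2 * W) * R e) (fun e => (key e).2) (fun e => le_of_eq (by ring)) ?_ ?_).1
  · exact hI.1
  · refine hI.2.trans_le ?_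
    rw [ha2, haq, ha2R, hBRe, hB1e, ← hρ']
    have hcoup := coupling_step hf w α τ hα hαw hτ y z u
    rw [← hx, ← hG] at hcoup
    -- The crux: with mean dual bound `12 ρ_n` and `w = 48 n² ρ_n L₂ α²`, the mirror cost of `‖G‖² /
    -- n` is at most the descent gain `D ‖G‖² / n`. The same inequality adds `1` to the factors `5`
    -- and `5/4`, giving `6` and `9/4`.
    have hαρ : (α * n) ^ 2 * ρ' ≤ D := by
      calc (α * n) ^ 2 * ρ' ≤ (α * n) ^ 2 * (12 * rho p n) := by gcongr
        _ = D := by rw [hD, hw]; field_simp; ring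
    have hq2 : α * n * κ * ∫ e, |q e| ∂(unifSphere n) ≤ α * Real.sqrt n * κ * ‖u - z‖ := by
      calc α * n * κ * ∫ e, |q e| ∂(unifSphere n) ≤ α * n * κ * (‖u - z‖ / Real.sqrt n) := by
            gcongr
        _ = α * (n / Real.sqrt n) * κ * ‖u - z‖ := by ring
        _ = _ := by rw [Real.div_sqrt]
    have hTσ : T / (n * m) ≤ σ ^ 2 / (m * n) := by
      rw [mul_comm (n : ℝ)]
      gcongr
    have hD0 : 0 ≤ D := by positivity
    have h1 := mul_le_mul_of_nonneg_right hαρ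
      (show 0 ≤ ‖G‖ ^ 2 / n + T / (n * m) + W by positivity)
    have h2 := mul_le_mul_of_nonneg_left hTσ (show 0 ≤ D * 6 by positivity)
    have e8 : D * 5 * (1 / (m : ℝ)) * (T / n) = D * 5 * (T / (n * m)) := by
      field_simp
    have e9 : (α * n) ^ 2 * (1 / (m : ℝ)) * (T / n * ρ') = (α * n) ^ 2 * ρ' * (T / (n * m)) := by
      field_simp
    have e10 : α * n * (⟪G, u - z⟫ / n) = α * ⟪G, u - z⟫ := by field_simp
    rw [e8, e9, e10]
    linarith

/-! ### Independence of the fresh samples from the past -/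

/-- `A`, `B` are the past directions and batches; `a`, `b` are the fresh ones. The three
independences make the joint law a fourfold product, and Tonelli reorders it. -/
lemma lintegral_eq_of_indepFun {Ω α β γ δ : Type*} [MeasurableSpace Ω] [MeasurableSpace α]
    [MeasurableSpace β] [MeasurableSpace γ] [MeasurableSpace δ] {μ : Measure Ω}
    [IsProbabilityMeasure μ] {A : Ω → α} {a : Ω → β} {B : Ω → γ} {b : Ω → δ}
    (hA : Measurable A) (ha : Measurable a) (hB : Measurable B) (hb : Measurable b)
    (h₁ : IndepFun A a μ) (h₂ : IndepFun B b μ)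
    (h₃ : IndepFun (fun ω => (A ω, a ω)) (fun ω => (B ω, b ω)) μ)
    {Φ : (α × γ) × (β × δ) → ENNReal} (hΦ : Measurable Φ) :
    ∫⁻ ω, Φ ((A ω, B ω), (a ω, b ω)) ∂μ =
      ∫⁻ ω, ∫⁻ x, ∫⁻ y, Φ ((A ω, B ω), (x, y)) ∂(μ.map b) ∂(μ.map a) ∂μ := by
  have := Measure.isProbabilityMeasure_map (μ := μ) hA.aemeasurable
  have := Measure.isProbabilityMeasure_map (μ := μ) ha.aemeasurable
  have := Measure.isProbabilityMeasure_map (μ := μ) hB.aemeasurable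
  have := Measure.isProbabilityMeasure_map (μ := μ) hb.aemeasurable
  have e₁ := (indepFun_iff_map_prod_eq_prod_map_map hA.aemeasurable ha.aemeasurable).1 h₁
  have e₂ := (indepFun_iff_map_prod_eq_prod_map_map hB.aemeasurable hb.aemeasurable).1 h₂
  have e₃ := (indepFun_iff_map_prod_eq_prod_map_map (hA.prodMk ha).aemeasurable
    (hB.prodMk hb).aemeasurable).1 h₃
  have h₄ : IndepFun A B μ := h₃.comp measurable_fst measurable_fst
  have e₄ := (indepFun_iff_map_prod_eq_prod_map_map hA.aemeasurable hB.aemeasurable).1 h₄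
  rw [e₁, e₂] at e₃
  have l₁ : ∫⁻ ω, Φ ((A ω, B ω), (a ω, b ω)) ∂μ =
      ∫⁻ q : (α × β) × (γ × δ), Φ ((q.1.1, q.2.1), (q.1.2, q.2.2))
        ∂(((μ.map A).prod (μ.map a)).prod ((μ.map B).prod (μ.map b))) := by
    rw [← e₃, lintegral_map (by fun_prop) (by fun_prop)]
  have hψ : Measurable fun q : α × γ => ∫⁻ x, ∫⁻ y, Φ (q, (x, y)) ∂(μ.map b) ∂(μ.map a) := by
    refine Measurable.lintegral_prod_right' (f := fun r : (α × γ) × β =>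
      ∫⁻ y, Φ (r.1, (r.2, y)) ∂(μ.map b)) ?_
    exact Measurable.lintegral_prod_right' (f := fun r : ((α × γ) × β) × δ =>
      Φ (r.1.1, (r.1.2, r.2))) (by fun_prop)
  have l₂ : ∫⁻ ω, ∫⁻ x, ∫⁻ y, Φ ((A ω, B ω), (x, y)) ∂(μ.map b) ∂(μ.map a) ∂μ =
      ∫⁻ q : α × γ, ∫⁻ x, ∫⁻ y, Φ (q, (x, y)) ∂(μ.map b) ∂(μ.map a)
        ∂((μ.map A).prod (μ.map B)) := by
    rw [← e₄, lintegral_map hψ (by fun_prop)]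
  rw [l₁, l₂, lintegral_prod _ (by fun_prop), lintegral_prod _ hψ.aemeasurable]
  have hin : Measurable fun r : α × β => ∫⁻ q : γ × δ, Φ ((r.1, q.1), (r.2, q.2))
      ∂((μ.map B).prod (μ.map b)) :=
    Measurable.lintegral_prod_right' (f := fun r : (α × β) × (γ × δ) =>
      Φ ((r.1.1, r.2.1), (r.1.2, r.2.2))) (by fun_prop)
  rw [lintegral_prod _ hin.aemeasurable]
  refine lintegral_congr fun u => ?_
  calc ∫⁻ x, ∫⁻ q : γ × δ, Φ ((u, q.1), (x, q.2)) ∂((μ.map B).prod (μ.map b)) ∂(μ.map a)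
      = ∫⁻ x, ∫⁻ v, ∫⁻ y, Φ ((u, v), (x, y)) ∂(μ.map b) ∂(μ.map B) ∂(μ.map a) := by
        refine lintegral_congr fun x => ?_
        rw [lintegral_prod _ (by fun_prop)]
    _ = _ := by
        rw [lintegral_lintegral_swap]
        refine Measurable.aemeasurable ?_
        exact Measurable.lintegral_prod_right' (f := fun r : (β × γ) × δ =>
          Φ ((u, r.1.2), (r.1.1, r.2))) (by fun_prop)

section Run

variable {n m : ℕ} {X : Type*}

lemma run_congr (p L₂ : ℝ) (d : E n → ℝ) (D : E n → X → S n → ℝ) (x₀ : E n)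
    {e e' : ℕ → S n} {s s' : ℕ → Fin m → X} {k : ℕ} (he : ∀ j < k, e j = e' j)
    (hs : ∀ j < k, s j = s' j) : run p L₂ d D x₀ e s k = run p L₂ d D x₀ e' s' k := by
  induction k with
  | zero => rfl
  | succ k ih =>
    rw [run, run, ih (fun j hj => he j (by omega)) (fun j hj => hs j (by omega)),
      he k (by omega), hs k (by omega)]

lemma step_y (p L₂ : ℝ) (d : E n → ℝ) (D : E n → X → S n → ℝ) (k : ℕ) (e : S n)
    (s : Fin m → X) (st : State n) :
    (step p L₂ d D k e s st).y =
      st.x k - (1 / (2 * L₂)) • batchMean (fun r => D (st.x k) r e) s • (e : E n) := by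
  rw [step, gradEst_eq]

lemma step_z (p L₂ : ℝ) (d : E n → ℝ) (D : E n → X → S n → ℝ) (k : ℕ) (e : S n)
    (s : Fin m → X) (st : State n) :
    (step p L₂ d D k e s st).z = proxPoint d (gradient d st.z - (alpha n p L₂ k * n) •
      batchMean (fun r => D (st.x k) r e) s • (e : E n)) := by
  rw [step, argmin_prox_eq, gradEst_eq]

variable [MeasurableSpace X]

lemma measurable_step {p : ℝ} (hp₁ : 1 ≤ p) (hp₂ : p ≤ 2) (L₂ : ℝ) {d : E n → ℝ}
    (hd : IsProxFunction p d) {D : E n → X → S n → ℝ}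
    (hD : Measurable fun t : E n × X × S n => D t.1 t.2.1 t.2.2) (k : ℕ)
    {α : Type*} [MeasurableSpace α] {y z : α → E n} {e : α → S n} {s : α → Fin m → X}
    (hy : Measurable y) (hz : Measurable z) (he : Measurable e) (hs : Measurable s) :
    Measurable (fun a => (step p L₂ d D k (e a) (s a) ⟨y a, z a⟩).y) ∧
      Measurable (fun a => (step p L₂ d D k (e a) (s a) ⟨y a, z a⟩).z) := by
  have hx : Measurable fun a => State.x ⟨y a, z a⟩ k := by
    unfold State.x
    fun_prop
  have hb : Measurable fun a => batchMean (fun r => D (State.x ⟨y a, z a⟩ k) r (e a)) (s a) := by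
    unfold batchMean
    refine Measurable.const_mul (Finset.measurable_fun_sum _ fun i _ => ?_) _
    exact hD.comp (hx.prodMk (((measurable_pi_apply i).comp hs).prodMk he))
  have hG : Measurable fun a =>
      batchMean (fun r => D (State.x ⟨y a, z a⟩ k) r (e a)) (s a) • (e a : E n) :=
    hb.smul (measurable_subtype_coe.comp he)
  simp only [step_y, step_z]
  refine ⟨hx.sub (hG.const_smul (1 / (2 * L₂))), ?_⟩
  exact (lipschitzWith_proxPoint hp₁ hp₂ hd).continuous.measurable.comp
    (((measurable_gradient d).comp hz).sub (hG.const_smul (alpha n p L₂ k * n)))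

lemma measurable_run {p : ℝ} (hp₁ : 1 ≤ p) (hp₂ : p ≤ 2) (L₂ : ℝ) {d : E n → ℝ}
    (hd : IsProxFunction p d) {D : E n → X → S n → ℝ}
    (hD : Measurable fun t : E n × X × S n => D t.1 t.2.1 t.2.2) (x₀ : E n)
    {α : Type*} [MeasurableSpace α] {e : ℕ → α → S n} {s : ℕ → α → Fin m → X} {k : ℕ}
    (he : ∀ j < k, Measurable (e j)) (hs : ∀ j < k, Measurable (s j)) :
    Measurable (fun a => (run p L₂ d D x₀ (fun j => e j a) (fun j => s j a) k).y) ∧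
      Measurable (fun a => (run p L₂ d D x₀ (fun j => e j a) (fun j => s j a) k).z) := by
  induction k with
  | zero => exact ⟨measurable_const, measurable_const⟩
  | succ k ih =>
    obtain ⟨h1, h2⟩ := ih (fun j hj => he j (by omega)) (fun j hj => hs j (by omega))
    exact measurable_step hp₁ hp₂ L₂ hd hD k h1 h2 (he k (by omega)) (hs k (by omega))

lemma lintegral_run_succ {p : ℝ} (hp₁ : 1 ≤ p) (hp₂ : p ≤ 2) (L₂ : ℝ) {d : E n → ℝ}
    (hd : IsProxFunction p d) {D : E n → X → S n → ℝ}
    (hD : Measurable fun t : E n × X × S n => D t.1 t.2.1 t.2.2) (x₀ : E n) {P : Measure X}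
    {N : ℕ} {Ω : Type*} [MeasurableSpace Ω] {μ : Measure Ω} [IsProbabilityMeasure μ]
    {e : ℕ → Ω → S n} {ξ : ℕ → Fin m → Ω → X}
    (he_meas : ∀ k < N, Measurable (e k))
    (he_law : ∀ k < N, μ.map (e k) = unifSphere n)
    (hξ_meas : ∀ k < N, ∀ i, Measurable (ξ k i))
    (hξ_law : ∀ k < N, ∀ i, μ.map (ξ k i) = P)
    (he_indep : iIndepFun (fun k : Fin N => e k) μ)
    (hξ_indep : iIndepFun (fun ki : Fin N × Fin m => ξ ki.1 ki.2) μ)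
    (heξ_indep : IndepFun (fun ω (k : Fin N) => e k ω)
      (fun ω (ki : Fin N × Fin m) => ξ ki.1 ki.2 ω) μ) {k : ℕ} (hk : k < N)
    {Φ : (E n × E n) × (S n × (Fin m → X)) → ENNReal} (hΦ : Measurable Φ) :
    ∫⁻ ω, Φ (((run p L₂ d D x₀ (fun j => e j ω) (fun j i => ξ j i ω) k).y,
        (run p L₂ d D x₀ (fun j => e j ω) (fun j i => ξ j i ω) k).z),
        (e k ω, fun i => ξ k i ω)) ∂μ =
      ∫⁻ ω, ∫⁻ v, ∫⁻ s, Φ (((run p L₂ d D x₀ (fun j => e j ω) (fun j i => ξ j i ω) k).y,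
        (run p L₂ d D x₀ (fun j => e j ω) (fun j i => ξ j i ω) k).z), (v, s))
        ∂(Measure.pi fun _ => P) ∂(unifSphere n) ∂μ := by
  set K : Fin N := ⟨k, hk⟩
  set I : Finset (Fin N) := Finset.univ.filter (· < K)
  set J : Finset (Fin N × Fin m) := Finset.univ.filter (·.1 < K)
  set J' : Finset (Fin N × Fin m) := Finset.univ.filter (·.1 = K)
  have hem : ∀ j : Fin N, Measurable (e j) := fun j => he_meas j j.2
  have hξm : ∀ j : Fin N × Fin m, Measurable (ξ j.1 j.2) := fun j => hξ_meas j.1 j.1.2 j.2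
  let A : Ω → (I → S n) := fun ω j => e j ω
  let B : Ω → (J → X) := fun ω j => ξ j.1.1 j.1.2 ω
  let b : Ω → (Fin m → X) := fun ω i => ξ k i ω
  have hA : Measurable A := measurable_pi_lambda _ fun j => hem j
  have hB : Measurable B := measurable_pi_lambda _ fun j => hξm j
  have hb : Measurable b := measurable_pi_lambda _ fun i => hξ_meas k hk i
  -- Values at `ω₀` fill the sequences outside the past. Any value would do, since `run` at time `k`
  -- reads only indices below `k`.
  obtain ⟨ω₀⟩ : Nonempty Ω := μ.nonempty_of_neZero
  -- the state as a function of the past samples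
  let e' : ℕ → (I → S n) × (J → X) → S n := fun j h =>
    if hj : ∃ hN : j < N, (⟨j, hN⟩ : Fin N) ∈ I then h.1 ⟨⟨j, hj.1⟩, hj.2⟩ else e k ω₀
  let s' : ℕ → (I → S n) × (J → X) → Fin m → X := fun j h i =>
    if hj : ∃ hN : j < N, ((⟨j, hN⟩ : Fin N), i) ∈ J then h.2 ⟨(⟨j, hj.1⟩, i), hj.2⟩ else ξ k i ω₀
  have he' : ∀ j, Measurable (e' j) := by
    intro j
    by_cases hj : ∃ hN : j < N, (⟨j, hN⟩ : Fin N) ∈ I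
    · simp only [e', dif_pos hj]
      exact (measurable_pi_apply _).comp measurable_fst
    · simp only [e', dif_neg hj]
      exact measurable_const
  have hs' : ∀ j, Measurable (s' j) := by
    intro j
    refine measurable_pi_lambda _ fun i => ?_
    by_cases hj : ∃ hN : j < N, ((⟨j, hN⟩ : Fin N), i) ∈ J
    · simp only [s', dif_pos hj]
      exact (measurable_pi_apply _).comp measurable_snd
    · simp only [s', dif_neg hj]
      exact measurable_const
  have hrun : ∀ ω, run p L₂ d D x₀ (fun j => e j ω) (fun j i => ξ j i ω) k =
      run p L₂ d D x₀ (fun j => e' j (A ω, B ω)) (fun j => s' j (A ω, B ω)) k := by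
    intro ω
    refine run_congr p L₂ d D x₀ (fun j hj => ?_) (fun j hj => ?_)
    · have : ∃ hN : j < N, (⟨j, hN⟩ : Fin N) ∈ I :=
        ⟨hj.trans hk, by simpa [I, K, Fin.lt_def] using hj⟩
      simp only [e', dif_pos this, A]
    · ext i
      have : ∃ hN : j < N, ((⟨j, hN⟩ : Fin N), i) ∈ J :=
        ⟨hj.trans hk, by simpa [J, K, Fin.lt_def] using hj⟩
      simp only [s', dif_pos this, B]
  obtain ⟨hy, hz⟩ := measurable_run hp₁ hp₂ L₂ hd hD x₀ (k := k) (fun j _ => he' j)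
    (fun j _ => hs' j)
  -- independence
  have h₁ : IndepFun A (e k) μ := by
    have h := he_indep.indepFun_finset I {K} (by simp [I]) hem
    exact h.comp (φ := id)
      (ψ := fun t : ({K} : Finset (Fin N)) → S n => t ⟨K, Finset.mem_singleton_self K⟩)
      measurable_id (measurable_pi_apply (⟨K, Finset.mem_singleton_self K⟩ : ({K} : Finset (Fin N))))
  have h₂ : IndepFun B b μ := by
    have h := hξ_indep.indepFun_finset J J' (by
      rw [Finset.disjoint_left]
      intro x hx hx'
      simp only [J, J', Finset.mem_filter] at hx hx'
      exact hx.2.ne hx'.2) hξm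
    exact h.comp (φ := id) (ψ := fun t i => t ⟨(K, i), by simp [J']⟩) measurable_id
      (measurable_pi_lambda _ fun i => measurable_pi_apply _)
  have h₃ : IndepFun (fun ω => (A ω, e k ω)) (fun ω => (B ω, b ω)) μ :=
    heξ_indep.comp (φ := fun t => ((fun j : I => t j), t K))
      (ψ := fun t => ((fun j : J => t j), fun i => t (K, i)))
      ((measurable_pi_lambda _ fun j => measurable_pi_apply _).prodMk (measurable_pi_apply _))
      ((measurable_pi_lambda _ fun j => measurable_pi_apply _).prodMk
        (measurable_pi_lambda _ fun i => measurable_pi_apply _))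
  have hblaw : μ.map b = Measure.pi fun _ => P := by
    have h : iIndepFun (fun i : Fin m => ξ k i) μ :=
      hξ_indep.precomp (g := fun i => (K, i)) fun i j h => (Prod.mk.inj h).2
    have h' := (iIndepFun_iff_map_fun_eq_pi_map fun i => (hξ_meas k hk i).aemeasurable).1 h
    simp only [hξ_law k hk] at h'
    exact h'
  have key := lintegral_eq_of_indepFun hA (he_meas k hk) hB hb h₁ h₂ h₃
    (Φ := fun q => Φ (((run p L₂ d D x₀ (fun j => e' j q.1) (fun j => s' j q.1) k).y,
      (run p L₂ d D x₀ (fun j => e' j q.1) (fun j => s' j q.1) k).z), q.2))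
    (hΦ.comp (((hy.comp measurable_fst).prodMk (hz.comp measurable_fst)).prodMk measurable_snd))
  rw [he_law k hk, hblaw] at key
  simp only [hrun]
  exact key

end Run

/-! ### The recursion over the iterations -/

/-- The weight `α_{k+1} / τ_k`. -/
def weight (n : ℕ) (p L₂ : ℝ) (k : ℕ) : ℝ := ((k : ℝ) + 2) ^ 2 / (192 * (n : ℝ) ^ 2 * rho p n * L₂)

section Weights

variable {n : ℕ} {p L₂ : ℝ}

lemma weight_pos (hn : 2 ≤ n) (hp₁ : 1 ≤ p) (hL : 0 < L₂) (k : ℕ) : 0 < weight n p L₂ k := by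
  have := rho_pos hn hp₁
  unfold weight
  positivity

lemma alpha_pos (hn : 2 ≤ n) (hp₁ : 1 ≤ p) (hL : 0 < L₂) (k : ℕ) : 0 < alpha n p L₂ k := by
  have := rho_pos hn hp₁
  unfold alpha
  positivity

lemma weight_mul_tau (k : ℕ) : weight n p L₂ k * tau k = alpha n p L₂ k := by
  unfold weight tau alpha
  have : (k : ℝ) + 2 ≠ 0 := by positivity
  rw [div_mul_div_comm, show (192 : ℝ) * n ^ 2 * rho p n * L₂ * (k + 2) =
    (96 * n ^ 2 * rho p n * L₂) * (2 * (k + 2)) by ring,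
    show ((k : ℝ) + 2) ^ 2 * 2 = (k + 2) * (2 * (k + 2)) by ring]
  rw [mul_div_mul_right _ _ (by positivity)]

lemma alpha_le_weight (hn : 2 ≤ n) (hp₁ : 1 ≤ p) (hL : 0 < L₂) (k : ℕ) :
    alpha n p L₂ k ≤ weight n p L₂ k := by
  rw [← weight_mul_tau]
  refine mul_le_of_le_one_right (weight_pos hn hp₁ hL k).le ?_
  unfold tau
  rw [div_le_one (by positivity)]
  linarith [(Nat.cast_nonneg k : (0 : ℝ) ≤ k)]

lemma weight_eq (hn : 2 ≤ n) (hp₁ : 1 ≤ p) (hL : 0 < L₂) (k : ℕ) :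
    weight n p L₂ k = 48 * n ^ 2 * rho p n * L₂ * alpha n p L₂ k ^ 2 := by
  have := rho_pos hn hp₁
  unfold weight alpha
  field_simp
  ring

/-- Because `τ_0 = 1`, the initial gap `f(x₀) - f(x*)` does not enter the bound. -/
lemma weight_zero_sub_alpha (hn : 2 ≤ n) (hp₁ : 1 ≤ p) (hL : 0 < L₂) :
    weight n p L₂ 0 - alpha n p L₂ 0 = 0 := by
  have := rho_pos hn hp₁
  unfold weight alpha
  field_simp
  norm_num

/-- Makes the potential telescope: up to the common denominator, `(k+3)² - 2(k+3) = (k+2)² - 1`. -/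
lemma weight_succ_sub_alpha_le (hn : 2 ≤ n) (hp₁ : 1 ≤ p) (hL : 0 < L₂) (k : ℕ) :
    weight n p L₂ (k + 1) - alpha n p L₂ (k + 1) ≤ weight n p L₂ k := by
  have := rho_pos hn hp₁
  have e : weight n p L₂ k - (weight n p L₂ (k + 1) - alpha n p L₂ (k + 1)) =
      1 / (192 * (n : ℝ) ^ 2 * rho p n * L₂) := by
    unfold weight alpha
    push_cast
    field_simp
    ring
  have : 0 ≤ 1 / (192 * (n : ℝ) ^ 2 * rho p n * L₂) := by positivity
  linarith

lemma weight_mono (hn : 2 ≤ n) (hp₁ : 1 ≤ p) (hL : 0 < L₂) {j k : ℕ} (h : j ≤ k) :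
    weight n p L₂ j ≤ weight n p L₂ k := by
  have := rho_pos hn hp₁
  unfold weight
  gcongr

lemma sum_alpha_le (hn : 2 ≤ n) (hp₁ : 1 ≤ p) (hL : 0 < L₂) (N : ℕ) :
    ∑ k ∈ Finset.range N, alpha n p L₂ k ≤ N * (N + 1) / (96 * (n : ℝ) ^ 2 * rho p n * L₂) := by
  have := rho_pos hn hp₁
  unfold alpha
  rw [← Finset.sum_div]
  gcongr
  calc ∑ k ∈ Finset.range N, ((k : ℝ) + 2) ≤ ∑ _k ∈ Finset.range N, ((N : ℝ) + 1) := by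
        refine Finset.sum_le_sum fun k hk => ?_
        have : (k : ℝ) + 1 ≤ N := by exact_mod_cast Finset.mem_range.1 hk
        linarith
    _ = _ := by
        simp
        ring

end Weights

/-- Optimizing over `l` would give the drift `b √(2Ψ)`, under which `√(2Ψ)` grows by about `b` per
step. This suggests the comparison sequence `(A + ∑ b)² / 2`, and `ε` keeps `A` positive. -/
lemma recursion_bound {Ψ : ℕ → ENNReal} {b c : ℕ → ℝ} (hb : ∀ k, 0 ≤ b k) (hc : ∀ k, 0 ≤ c k)
    {N : ℕ} {Θ : ℝ} (hΘ : 0 ≤ Θ) (h0 : Ψ 0 ≤ ENNReal.ofReal Θ)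
    (hstep : ∀ k < N, ∀ l : ℝ, 0 < l → Ψ (k + 1) ≤
      ENNReal.ofReal (1 + b k * l) * Ψ k + ENNReal.ofReal (c k + b k / (2 * l)))
    {ε : ℝ} (hε : 0 < ε) :
    Ψ N ≤ ENNReal.ofReal (2 * (Θ + ∑ k ∈ Finset.range N, c k + ε) +
      (∑ k ∈ Finset.range N, b k) ^ 2) := by
  set C := ∑ k ∈ Finset.range N, c k
  have hC : 0 ≤ C := Finset.sum_nonneg fun k _ => hc k
  set A := Real.sqrt (2 * (Θ + C + ε))
  have hA : 0 < A := Real.sqrt_pos.2 (by linarith)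
  have hA2 : A ^ 2 = 2 * (Θ + C + ε) := Real.sq_sqrt (by linarith)
  -- All additive errors are charged to `A` in advance; `C - ∑ c` is the part not yet spent.
  have main : ∀ k ≤ N, Ψ k ≤ ENNReal.ofReal ((A + ∑ j ∈ Finset.range k, b j) ^ 2 / 2 -
      (C - ∑ j ∈ Finset.range k, c j)) := by
    intro k hk
    induction k with
    | zero =>
      refine h0.trans (ENNReal.ofReal_le_ofReal ?_)
      simp only [Finset.range_zero, Finset.sum_empty]
      linarith
    | succ k ih =>
      have ih := ih (by omega)
      rw [Finset.sum_range_succ, Finset.sum_range_succ]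
      have hB0 : 0 ≤ ∑ j ∈ Finset.range k, b j := Finset.sum_nonneg fun j _ => hb j
      have hC0 : 0 ≤ ∑ j ∈ Finset.range k, c j := Finset.sum_nonneg fun j _ => hc j
      have hCk : ∑ j ∈ Finset.range k, c j ≤ C :=
        Finset.sum_le_sum_of_subset_of_nonneg (Finset.range_mono (by omega)) fun j _ _ => hc j
      set B := ∑ j ∈ Finset.range k, b j
      set Ck := ∑ j ∈ Finset.range k, c j
      have hr : 0 < A + B := by linarith
      have hb' := hb k
      have hc' := hc k
      have hM : 0 ≤ (A + B) ^ 2 / 2 - (C - Ck) := by nlinarith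
      refine (hstep k (by omega) (1 / (A + B)) (by positivity)).trans ?_
      calc _ ≤ ENNReal.ofReal (1 + b k * (1 / (A + B))) *
            ENNReal.ofReal ((A + B) ^ 2 / 2 - (C - Ck)) +
            ENNReal.ofReal (c k + b k / (2 * (1 / (A + B)))) := by gcongr
        _ = ENNReal.ofReal ((1 + b k * (1 / (A + B))) * ((A + B) ^ 2 / 2 - (C - Ck)) +
            (c k + b k / (2 * (1 / (A + B))))) := by
          rw [← ENNReal.ofReal_mul (by positivity), ← ENNReal.ofReal_add (by positivity)
            (by positivity)]
        _ ≤ _ := by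
          refine ENNReal.ofReal_le_ofReal ?_
          have e1 : b k / (2 * (1 / (A + B))) = b k * (A + B) / 2 := by field_simp
          have e2 : b k * (1 / (A + B)) * ((A + B) ^ 2 / 2) = b k * (A + B) / 2 := by field_simp
          have e3 : 0 ≤ b k * (1 / (A + B)) * (C - Ck) := by
            have : 0 ≤ C - Ck := by linarith
            positivity
          rw [e1]
          nlinarith [sq_nonneg (b k)]
  refine (main N le_rfl).trans (ENNReal.ofReal_le_ofReal ?_)
  set B := ∑ j ∈ Finset.range N, b j
  -- `(A + B)² / 2 ≤ A² + B²`.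
  nlinarith [sq_nonneg (A - B)]

lemma integrable_and_integral_le_of_lintegral {Ω : Type*} [MeasurableSpace Ω] {μ : Measure Ω}
    {φ : Ω → ℝ} (hφ : Measurable φ) (h0 : ∀ ω, 0 ≤ φ ω) {K : ℝ} (hK : 0 ≤ K)
    (h : ∫⁻ ω, ENNReal.ofReal (φ ω) ∂μ ≤ ENNReal.ofReal K) :
    Integrable φ μ ∧ ∫ ω, φ ω ∂μ ≤ K := by
  constructor
  · refine ⟨hφ.aestronglyMeasurable, ?_⟩
    rw [hasFiniteIntegral_iff_ofReal (Filter.Eventually.of_forall h0)]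
    exact h.trans_lt ENNReal.ofReal_lt_top
  · rw [integral_eq_lintegral_of_nonneg_ae (Filter.Eventually.of_forall h0)
      hφ.aestronglyMeasurable]
    exact ENNReal.toReal_le_of_le_ofReal hK h

lemma norm_le_mul_bregman_add {n : ℕ} {p : ℝ} (hp₁ : 1 ≤ p) (hp₂ : p ≤ 2) {d : E n → ℝ}
    (hd : IsProxFunction p d) (z u : E n) {l : ℝ} (hl : 0 < l) :
    ‖u - z‖ ≤ l * bregman d z u + 1 / (2 * l) := by
  have h := norm_sq_le_bregman hp₁ hp₂ hd z u
  have h1 : ‖u - z‖ ≤ l * (‖u - z‖ ^ 2 / 2) + 1 / (2 * l) := by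
    have : l * (‖u - z‖ ^ 2 / 2) + 1 / (2 * l) - ‖u - z‖ = (l * ‖u - z‖ - 1) ^ 2 / (2 * l) := by
      field_simp
      ring
    have : 0 ≤ (l * ‖u - z‖ - 1) ^ 2 / (2 * l) := by positivity
    linarith
  nlinarith

/-- The final comparison of constants. -/
lemma final_bound {n : ℕ} (hn : 2 ≤ n) {p : ℝ} (hp₁ : 1 ≤ p) {L₂ σ Θ Δζ Δη : ℝ} (hL : 0 < L₂)
    (hΘ : 0 ≤ Θ) (hΔζ : 0 ≤ Δζ) (hΔη : 0 ≤ Δη) {N m : ℕ} (hN : 1 ≤ N) (hm : 1 ≤ m) :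
    (2 * (Θ + ∑ k ∈ Finset.range N, weight n p L₂ k / (4 * L₂) *
        (6 * (σ ^ 2 / (m * n)) + 9 / 4 * (2 * Δζ + 2 * Δη ^ 2))) +
      (∑ k ∈ Finset.range N, alpha n p L₂ k * Real.sqrt n * (Real.sqrt Δζ + Δη)) ^ 2) /
      weight n p L₂ (N - 1) ≤
      384 * Θ * n ^ 2 * rho p n * L₂ / N ^ 2
        + 4 * N / (n * L₂) * (σ ^ 2 / m)
        + 61 * N / (24 * L₂) * Δζ
        + 122 * N / (3 * L₂) * Δη ^ 2
        + 12 * Real.sqrt (2 * n * Θ) / N ^ 2 * (Real.sqrt Δζ / 2 + 2 * Δη)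
        + N ^ 2 / (12 * n * rho p n * L₂) * (Real.sqrt Δζ / 2 + 2 * Δη) ^ 2 := by
  have hρ := rho_pos hn hp₁
  have hw := weight_pos hn hp₁ hL (N - 1)
  have hn0 : (0 : ℝ) < n := by positivity
  have hm0 : (0 : ℝ) < m := by positivity
  have hN0 : (0 : ℝ) < N := by positivity
  set C₀ := 6 * (σ ^ 2 / (m * n)) + 9 / 4 * (2 * Δζ + 2 * Δη ^ 2) with hC₀
  have hC₀0 : 0 ≤ C₀ := by positivity
  set δ := Real.sqrt Δζ / 2 + 2 * Δη with hδ
  have hδ0 : 0 ≤ δ := by positivity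
  set κ := Real.sqrt Δζ + Δη with hκ
  have hκ0 : 0 ≤ κ := by positivity
  have hweq : weight n p L₂ (N - 1) = ((N : ℝ) + 1) ^ 2 / (192 * (n : ℝ) ^ 2 * rho p n * L₂) := by
    unfold weight
    push_cast [hN]
    ring
  have t1 : 2 * Θ / weight n p L₂ (N - 1) ≤ 384 * Θ * n ^ 2 * rho p n * L₂ / N ^ 2 := by
    calc 2 * Θ / weight n p L₂ (N - 1) = 384 * Θ * n ^ 2 * rho p n * L₂ / (N + 1) ^ 2 := by
          rw [hweq]; field_simp; ring
      _ ≤ _ := by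
          gcongr
          linarith
  have t2 : 2 * (∑ k ∈ Finset.range N, weight n p L₂ k / (4 * L₂) * C₀) / weight n p L₂ (N - 1) ≤
      N * C₀ / (2 * L₂) := by
    rw [div_le_iff₀ hw]
    calc 2 * (∑ k ∈ Finset.range N, weight n p L₂ k / (4 * L₂) * C₀)
        ≤ 2 * ∑ _k ∈ Finset.range N, weight n p L₂ (N - 1) / (4 * L₂) * C₀ := by
          gcongr with k hk
          exact weight_mono hn hp₁ hL (by have := Finset.mem_range.1 hk; omega)
      _ = _ := by
          simp only [Finset.sum_const, Finset.card_range, nsmul_eq_mul]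
          field_simp
          ring
  have t3 : (∑ k ∈ Finset.range N, alpha n p L₂ k * Real.sqrt n * κ) ^ 2 /
      weight n p L₂ (N - 1) ≤ N ^ 2 / (12 * n * rho p n * L₂) * δ ^ 2 := by
    rw [← Finset.sum_mul, ← Finset.sum_mul]
    have h1 := sum_alpha_le hn hp₁ hL N (L₂ := L₂)
    have h2 : 0 ≤ ∑ k ∈ Finset.range N, alpha n p L₂ k :=
      Finset.sum_nonneg fun k _ => (alpha_pos hn hp₁ hL k).le
    -- With this factor `2` the constant `1/12` comes out exactly: `4 · 192 / 96² = 1/12`.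
    have h3 : κ ≤ 2 * δ := by rw [hκ, hδ]; linarith
    calc _ ≤ (N * (N + 1) / (96 * (n : ℝ) ^ 2 * rho p n * L₂) * Real.sqrt n * (2 * δ)) ^ 2 /
          weight n p L₂ (N - 1) := by gcongr
      _ = _ := by
        rw [mul_pow, mul_pow, Real.sq_sqrt hn0.le, hweq]
        field_simp
        ring
  have t4 : N * C₀ / (2 * L₂) ≤ 4 * N / (n * L₂) * (σ ^ 2 / m) + 61 * N / (24 * L₂) * Δζ
        + 122 * N / (3 * L₂) * Δη ^ 2 := by
    have e : 4 * N / (n * L₂) * (σ ^ 2 / m) + 61 * N / (24 * L₂) * Δζ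
        + 122 * N / (3 * L₂) * Δη ^ 2 - N * C₀ / (2 * L₂) =
        N / (n * L₂) * (σ ^ 2 / m) + 7 / 24 * (N / L₂) * Δζ + 461 / 12 * (N / L₂) * Δη ^ 2 := by
      rw [hC₀]
      field_simp
      ring
    have : 0 ≤ N / (n * L₂) * (σ ^ 2 / m) + 7 / 24 * (N / L₂) * Δζ +
        461 / 12 * (N / L₂) * Δη ^ 2 := by positivity
    linarith
  -- The recursion produces no cross term between `Θ` and the noise, so this summand is pure slack.
  have t5 : 0 ≤ 12 * Real.sqrt (2 * n * Θ) / N ^ 2 * δ := by positivity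
  rw [add_div, mul_add, add_div]
  linarith

end ARDD

end

/-! ### Assembly: the potential along the run and the final division by the weight -/

theorem mainTheorem6
    (n : ℕ) (hn : 2 ≤ n)
    (p : ℝ) (hp₁ : 1 ≤ p) (hp₂ : p ≤ 2)
    -- the stochastic convex optimization problem
    {X : Type*} [MeasurableSpace X] (P : Measure X) [IsProbabilityMeasure P]
    (F : ARDD.E n → X → ℝ) (g : ARDD.E n → X → ARDD.E n) (L : X → ℝ) (L₂ σ : ℝ)
    (hF_int : ∀ x, Integrable (F x) P)
    (hF_conv : ∀ᵐ s ∂P, ConvexOn ℝ Set.univ fun x => F x s)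
    (hg_meas : Measurable fun t : ARDD.E n × X => g t.1 t.2)
    (hg_grad : ∀ᵐ s ∂P, ∀ x, HasGradientAt (fun x => F x s) (g x s) x)
    (hg_lip : ∀ᵐ s ∂P, ∀ x y, ‖g x s - g y s‖ ≤ L s * ‖x - y‖)
    (hL : MemLp L 2 P) (hL₂ : Real.sqrt (∫ s, L s ^ 2 ∂P) ≤ L₂) (hL₂_pos : 0 < L₂)
    (hσ : ∀ x, Integrable (fun s => ‖g x s - gradient (ARDD.objective P F) x‖ ^ 2) P ∧
      ∫ s, ‖g x s - gradient (ARDD.objective P F) x‖ ^ 2 ∂P ≤ σ ^ 2)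
    -- the noise in the directional derivatives
    (ζ η : ARDD.E n → X → ARDD.S n → ℝ) (Δζ Δη : ℝ)
    (hζ_meas : Measurable fun t : ARDD.E n × X × ARDD.S n => ζ t.1 t.2.1 t.2.2)
    (hη_meas : Measurable fun t : ARDD.E n × X × ARDD.S n => η t.1 t.2.1 t.2.2)
    (hζ : ∀ x e, Integrable (fun s => ζ x s e ^ 2) P ∧ ∫ s, ζ x s e ^ 2 ∂P ≤ Δζ)
    (hη : ∀ x e, ∀ᵐ s ∂P, |η x s e| ≤ Δη)
    -- the proximal setup, the starting point, a solution of the problem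
    (d : ARDD.E n → ℝ) (hd : ARDD.IsProxFunction p d)
    (x₀ xs : ARDD.E n)
    (hxs : ∀ x, ARDD.objective P F xs ≤ ARDD.objective P F x)
    -- number of iterations, batch size, and the independent samples
    (N m : ℕ) (hN : 1 ≤ N) (hm : 1 ≤ m)
    {Ω : Type*} [MeasurableSpace Ω] (μ : Measure Ω) [IsProbabilityMeasure μ]
    (e : ℕ → Ω → ARDD.S n) (ξ : ℕ → Fin m → Ω → X)
    (he_meas : ∀ k < N, Measurable (e k))
    (he_law : ∀ k < N, μ.map (e k) = ARDD.unifSphere n)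
    (hξ_meas : ∀ k < N, ∀ i, Measurable (ξ k i))
    (hξ_law : ∀ k < N, ∀ i, μ.map (ξ k i) = P)
    (he_indep : iIndepFun (fun k : Fin N => e k) μ)
    (hξ_indep : iIndepFun (fun ki : Fin N × Fin m => ξ ki.1 ki.2) μ)
    (heξ_indep : IndepFun (fun ω (k : Fin N) => e k ω)
      (fun ω (ki : Fin N × Fin m) => ξ ki.1 ki.2 ω) μ) :
    let f := ARDD.objective P F
    let ρ := ARDD.rho p n
    let Θ := ARDD.bregman d x₀ xs
    let yN : Ω → ARDD.E n := fun ω =>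
      (ARDD.run p L₂ d (ARDD.noisyDeriv g ζ η) x₀
        (fun k => e k ω) (fun k i => ξ k i ω) N).y
    Integrable (fun ω => f (yN ω)) μ ∧
    (∫ ω, f (yN ω) ∂μ) - f xs ≤
      384 * Θ * n ^ 2 * ρ * L₂ / N ^ 2
        + 4 * N / (n * L₂) * (σ ^ 2 / m)
        + 61 * N / (24 * L₂) * Δζ
        + 122 * N / (3 * L₂) * Δη ^ 2
        + 12 * Real.sqrt (2 * n * Θ) / N ^ 2 * (Real.sqrt Δζ / 2 + 2 * Δη)
        + N ^ 2 / (12 * n * ρ * L₂) * (Real.sqrt Δζ / 2 + 2 * Δη) ^ 2 := by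
  intro f ρ Θ yN
  have hg_int : ∀ x, Integrable (g x) P := fun x => by
    have h := ARDD.memLp_sub_of_integrable_sq (hg_meas.comp measurable_prodMk_left) _ (hσ x).1
    refine ((h.integrable one_le_two).add (integrable_const
      (gradient (ARDD.objective P F) x))).congr (Filter.Eventually.of_forall fun s => ?_)
    simp
  have hgrad : ∀ x, HasGradientAt f (∫ s, g x s ∂P) x :=
    ARDD.gradient_objective hF_int hF_conv hg_grad hg_lip hL hL₂ hg_int
  have hf : ARDD.IsSmoothConvex f L₂ :=
    ARDD.isSmoothConvex_objective hF_int hF_conv hg_grad hg_lip hL hL₂ hg_int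
  have hf_cont : Continuous f := continuous_iff_continuousAt.2 fun x => (hgrad x).continuousAt
  have hD : Measurable fun t : ARDD.E n × X × ARDD.S n =>
      ARDD.noisyDeriv g ζ η t.1 t.2.1 t.2.2 := by
    have h1 : Measurable fun t : ARDD.E n × X × ARDD.S n => g t.1 t.2.1 :=
      hg_meas.comp (measurable_fst.prodMk (measurable_fst.comp measurable_snd))
    have h2 : Measurable fun t : ARDD.E n × X × ARDD.S n => (t.2.2 : ARDD.E n) := by fun_prop
    exact ((h1.inner h2).add hζ_meas).add hη_meas
  have := ARDD.isProbabilityMeasure_unifSphere hn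
  obtain ⟨e₀⟩ : Nonempty (ARDD.S n) := (ARDD.unifSphere n).nonempty_of_neZero
  have hΔζ : 0 ≤ Δζ := (integral_nonneg fun s => sq_nonneg _).trans (hζ x₀ e₀).2
  have hΔη : 0 ≤ Δη := by
    obtain ⟨s, hs⟩ := (hη x₀ e₀).exists
    exact (abs_nonneg _).trans hs
  have hΘ : 0 ≤ Θ := ARDD.bregman_nonneg hd x₀ xs
  have hρ := ARDD.rho_pos hn hp₁
  set st : ℕ → Ω → ARDD.State n := fun k ω =>
    ARDD.run p L₂ d (ARDD.noisyDeriv g ζ η) x₀ (fun k => e k ω) (fun k i => ξ k i ω) k with hst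
  have hmeas : ∀ k ≤ N, Measurable (fun ω => (st k ω).y) ∧ Measurable (fun ω => (st k ω).z) :=
    fun k hk => ARDD.measurable_run hp₁ hp₂ L₂ hd hD x₀ (e := e) (s := fun j ω i => ξ j i ω)
      (fun j hj => he_meas j (by omega))
      (fun j hj => measurable_pi_lambda _ fun i => hξ_meas j (by omega) i)
  have hbreg : Measurable fun z => ARDD.bregman d z xs := by
    unfold ARDD.bregman
    have h1 := hd.differentiable.continuous.measurable
    have h2 := ARDD.measurable_gradient d
    fun_prop
  -- The weight of `f(y_k) - f(x*)` is the one created by the preceding iteration, hence shifted by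
  -- one and zero at the start.
  let v : ℕ → ℝ := fun k => Nat.casesOn k 0 (ARDD.weight n p L₂)
  let Ψ : ℕ → ENNReal := fun k => ∫⁻ ω, ENNReal.ofReal
    (v k * (f (st k ω).y - f xs) + ARDD.bregman d (st k ω).z xs) ∂μ
  let C₀ := 6 * (σ ^ 2 / (m * n)) + 9 / 4 * (2 * Δζ + 2 * Δη ^ 2)
  let b : ℕ → ℝ := fun k => ARDD.alpha n p L₂ k * Real.sqrt n * (Real.sqrt Δζ + Δη)
  let c : ℕ → ℝ := fun k => ARDD.weight n p L₂ k / (4 * L₂) * C₀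
  have hb : ∀ k, 0 ≤ b k := fun k => by
    have := ARDD.alpha_pos hn hp₁ hL₂_pos k
    positivity
  have hc : ∀ k, 0 ≤ c k := fun k => by
    have := ARDD.weight_pos hn hp₁ hL₂_pos k
    positivity
  have hv : ∀ k, ARDD.weight n p L₂ k - ARDD.alpha n p L₂ k ≤ v k := fun k => by
    cases k with
    | zero => exact (ARDD.weight_zero_sub_alpha hn hp₁ hL₂_pos).le
    | succ k => exact ARDD.weight_succ_sub_alpha_le hn hp₁ hL₂_pos k
  have hv0 : ∀ k, 0 ≤ v k := fun k => by
    cases k with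
    | zero => exact le_rfl
    | succ k => exact (ARDD.weight_pos hn hp₁ hL₂_pos k).le
  have hΨ0 : Ψ 0 ≤ ENNReal.ofReal Θ := by
    simp [Ψ, v, hst, ARDD.run, Θ]
  have hstep : ∀ k < N, ∀ l : ℝ, 0 < l → Ψ (k + 1) ≤
      ENNReal.ofReal (1 + b k * l) * Ψ k + ENNReal.ofReal (c k + b k / (2 * l)) := by
    intro k hk l hl
    obtain ⟨hy, hz⟩ := hmeas k hk.le
    let Φ : (ARDD.E n × ARDD.E n) × (ARDD.S n × (Fin m → X)) → ENNReal := fun q =>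
      ENNReal.ofReal (ARDD.weight n p L₂ k *
        (f (ARDD.step p L₂ d (ARDD.noisyDeriv g ζ η) k q.2.1 q.2.2 ⟨q.1.1, q.1.2⟩).y - f xs) +
        ARDD.bregman d
          (ARDD.step p L₂ d (ARDD.noisyDeriv g ζ η) k q.2.1 q.2.2 ⟨q.1.1, q.1.2⟩).z xs)
    have hΦ : Measurable Φ := by
      obtain ⟨h1, h2⟩ := ARDD.measurable_step hp₁ hp₂ L₂ hd hD k
        (α := (ARDD.E n × ARDD.E n) × (ARDD.S n × (Fin m → X))) (y := fun q => q.1.1)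
        (z := fun q => q.1.2) (e := fun q => q.2.1) (s := fun q => q.2.2) (by fun_prop)
        (by fun_prop) (by fun_prop) (by fun_prop)
      exact (((hf_cont.measurable.comp h1).sub_const _).const_mul _ |>.add
        (hbreg.comp h2)).ennreal_ofReal
    have h1 := ARDD.lintegral_run_succ hp₁ hp₂ L₂ hd hD x₀ he_meas he_law hξ_meas hξ_law he_indep
      hξ_indep heξ_indep hk hΦ
    have h2 : ∀ y z : ARDD.E n, ∫⁻ v, ∫⁻ s, Φ ((y, z), (v, s)) ∂(Measure.pi fun _ => P)
        ∂(ARDD.unifSphere n) ≤ ENNReal.ofReal (1 + b k * l) *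
          ENNReal.ofReal (v k * (f y - f xs) + ARDD.bregman d z xs) +
          ENNReal.ofReal (c k + b k / (2 * l)) := by
      intro y z
      have hx : (ARDD.State.x ⟨y, z⟩ k) = ARDD.tau k • z + (1 - ARDD.tau k) • y := rfl
      have h := ARDD.one_step_fixed_state (γ := g (ARDD.State.x ⟨y, z⟩ k))
        (Z := ζ (ARDD.State.x ⟨y, z⟩ k)) (H := η (ARDD.State.x ⟨y, z⟩ k)) hn hp₁ hp₂ hd hL₂_pos hf hxs hm y z
        (ARDD.alpha_pos hn hp₁ hL₂_pos k).le (ARDD.alpha_le_weight hn hp₁ hL₂_pos k)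
        (ARDD.weight_mul_tau k) (ARDD.weight_eq hn hp₁ hL₂_pos k) hx
        (hg_meas.comp measurable_prodMk_left) (hσ _).1 (hgrad _).gradient.symm (hσ _).2
        (fun e => hζ_meas.comp (measurable_const.prodMk (measurable_id.prodMk measurable_const)))
        (fun e => hη_meas.comp (measurable_const.prodMk (measurable_id.prodMk measurable_const)))
        hΔη (fun e => (hζ _ e).1) (fun e => (hζ _ e).2) (fun e => hη _ e)
      have hy0 : 0 ≤ f y - f xs := sub_nonneg.2 (hxs y)
      have hV0 := ARDD.bregman_nonneg hd z xs
      have hvk := hv0 k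
      have hbk := hb k
      have hck := hc k
      refine (le_of_eq ?_).trans (h.trans ?_)
      · simp only [Φ, ARDD.step_y, ARDD.step_z]
        rfl
      rw [← ENNReal.ofReal_mul (by positivity), ← ENNReal.ofReal_add (by positivity)
        (by positivity)]
      refine ENNReal.ofReal_le_ofReal ?_
      have i1 := mul_le_mul_of_nonneg_right (hv k) hy0
      have i2 := mul_le_mul_of_nonneg_left (ARDD.norm_le_mul_bregman_add hp₁ hp₂ hd z xs hl) hbk
      have i3 : 0 ≤ b k * l * (v k * (f y - f xs)) := by positivity
      have i4 : b k * (1 / (2 * l)) = b k / (2 * l) := by ring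
      change _ + _ + c k + b k * ‖xs - z‖ ≤ _
      linarith
    calc Ψ (k + 1) = _ := h1
      _ ≤ ∫⁻ ω, (ENNReal.ofReal (1 + b k * l) * ENNReal.ofReal
          (v k * (f (st k ω).y - f xs) + ARDD.bregman d (st k ω).z xs) +
          ENNReal.ofReal (c k + b k / (2 * l))) ∂μ := lintegral_mono fun ω => h2 _ _
      _ = _ := by
        rw [lintegral_add_right _ measurable_const, lintegral_const_mul' _ _ ENNReal.ofReal_ne_top]
        simp [Ψ]
  obtain ⟨M, rfl⟩ : ∃ M, N = M + 1 := ⟨N - 1, by omega⟩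
  have hw := ARDD.weight_pos hn hp₁ hL₂_pos M
  obtain ⟨hy, hz⟩ := hmeas (M + 1) le_rfl
  set K := 2 * (Θ + ∑ k ∈ Finset.range (M + 1), c k) + (∑ k ∈ Finset.range (M + 1), b k) ^ 2 with hK
  have hK0 : 0 ≤ K := by
    have : 0 ≤ ∑ k ∈ Finset.range (M + 1), c k := Finset.sum_nonneg fun k _ => hc k
    positivity
  -- The Bregman part of the final potential is dropped, and `ε` is removed after passing to real
  -- integrals.
  have hfin : ∀ ε : ℝ, 0 < ε →
      Integrable (fun ω => ARDD.weight n p L₂ M * (f (yN ω) - f xs)) μ ∧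
      ∫ ω, ARDD.weight n p L₂ M * (f (yN ω) - f xs) ∂μ ≤ K + ε := by
    intro ε hε
    refine ARDD.integrable_and_integral_le_of_lintegral
      (((hf_cont.measurable.comp hy).sub_const _).const_mul _)
      (fun ω => mul_nonneg hw.le (sub_nonneg.2 (hxs _))) (by positivity) ?_
    have h := ARDD.recursion_bound hb hc hΘ hΨ0 hstep (half_pos hε)
    rw [show 2 * (Θ + ∑ k ∈ Finset.range (M + 1), c k + ε / 2) +
      (∑ k ∈ Finset.range (M + 1), b k) ^ 2 = K + ε by rw [hK]; ring] at h
    refine le_trans (lintegral_mono fun ω => ENNReal.ofReal_le_ofReal ?_) h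
    exact le_add_of_nonneg_right (ARDD.bregman_nonneg hd _ _)
  have hint := (hfin 1 one_pos).1
  have hint2 : Integrable (fun ω => f (yN ω)) μ := by
    refine ((hint.const_mul (ARDD.weight n p L₂ M)⁻¹).add (integrable_const (f xs))).congr
      (Filter.Eventually.of_forall fun ω => ?_)
    simp only [Pi.add_apply]
    field_simp
    ring
  refine ⟨hint2, ?_⟩
  have hle : ARDD.weight n p L₂ M * ((∫ ω, f (yN ω) ∂μ) - f xs) ≤ K := by
    refine le_of_forall_pos_le_add fun ε hε => ?_
    have h := (hfin ε hε).2
    rw [integral_const_mul, integral_sub hint2 (integrable_const _)] at h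
    simpa using h
  refine le_trans ?_ (ARDD.final_bound hn hp₁ hL₂_pos hΘ hΔζ hΔη hN hm)
  rw [le_div_iff₀ (by simpa using hw), mul_comm]
  simpa using hle
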